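/- **Setting.** All topological spaces are $T_0$. A *transitive model* is a transitive class $M$ (a set or a proper class) of the universe $V$ of sets that satisfies ZFC. A space is *Čech complete* if it is a $G_\delta$ subspace of a compact Hausdorff space, and *interpretable* if it is regular Hausdorff and is the image of a Čech complete space under a continuous open map. Let $M$ be a transitive model and let $M\models\langle X,\tau\rangle$ be a topological space. A *preinterpretation* of $X$ over $M$ is a topological space $\langle\hat X,\hat\tau\rangle$ together with a map $\pi$ consisting of a map $\pi\colon X\to\hat X$ on points and a map $\pi\colon\tau\to\hat\tau$ on open sets such that 1. for all $x\in X$ and $O\in\tau$, $x\in O$ if and only if $\pi(x)\in\pi(O)$; 2. $\pi(O\cap P)=\pi(O)\cap\pi(P)$ for all $O,P\in\tau$, and $\pi(\bigcup C)=\bigcup_{O\in C}\pi(O)$ for every $C\in M$ with $C\subseteq\tau$; 3. $\pi(\emptyset)=\emptyset$ and $\pi(X)=\hat X$; 4. $\{\pi(O)\colon O\in\tau\}$ is a basis of $\hat\tau$. If $\pi\colon X\to\hat X$ and $\pi'\colon X\to\hat X'$ are preinterpretations over $M$, a *reduction* of $\pi'$ to $\pi$ is a map $h\colon\hat X'\to\hat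 X$ such that $h(\pi'(x))=\pi(x)$ for all $x\in X$ and $h^{-1}(\pi(O))=\pi'(O)$ for all $O\in\tau$. An *interpretation* of $X$ over $M$ is a preinterpretation $\pi$ over $M$ such that every preinterpretation of $X$ over $M$ has a reduction to $\pi$. **Theorem.** Let $M_0\subseteq M_1$ be transitive models. Suppose that $M_0\models\langle X_0,\tau_0\rangle$ is an interpretable space, that $M_1\models\pi_0\colon\langle X_0,\tau_0\rangle\to\langle X_1,\tau_1\rangle$ is an interpretation over $M_0$ (that is, the space, the maps, the competing preinterpretations and the reductions in the definition are all taken in $M_1$), and that $\pi_1\colon\langle X_1,\tau_1\rangle\to\langle X_2,\tau_2\rangle$ is, in $V$, an interpretation over $M_1$. Then $\pi_1\circ\pi_0\colon\langle X_0,\tau_0\rangle\to\langle X_2,\tau_2\rangle$ (composed on points and on open sets) is, in $V$, an interpretation over $M_0$. -/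

import Mathlib

universe u

open scoped ZFSet

namespace TopInterp

/-! ### Transitive models of ZFC

The universe `V` is `ZFSet.{u}`.  A transitive model is a transitive class `M : Set ZFSet.{u}`
(it may be a set or a proper class) which satisfies every axiom of ZFC. -/

/-- The only non-logical symbol of the language of set theory. -/
inductive MemRel : ℕ → Type
  | mem : MemRel 2

/-- The first-order language of set theory. -/
def setLang : FirstOrder.Language := ⟨fun _ => Empty, MemRel⟩

/-- The structure `(M, ∈)`. -/
instance memStructure (M : Set ZFSet.{u}) : setLang.Structure M where
  funMap := fun f _ => Empty.elim f
  RelMap := fun {_} r =>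
    match r with
    | MemRel.mem => fun v => (v 0 : ZFSet.{u}) ∈ (v 1 : ZFSet.{u})

/-- `M` is a transitive class and `(M, ∈)` satisfies ZFC.  Each field is the satisfaction in
`(M, ∈)` of one axiom or axiom schema; Extensionality and Foundation hold in every transitive
class.  `Set.Definable₁ Set.univ setLang` and `Set.Definable₂ Set.univ setLang` mean: definable
over `(M, ∈)` by a first-order formula with parameters from `M`. -/
structure IsTransitiveModel (M : Set ZFSet.{u}) : Prop where
  transitive : ∀ x ∈ M, ∀ y ∈ x, y ∈ M
  pairing : ∀ x ∈ M, ∀ y ∈ M, ∃ z ∈ M, ∀ w ∈ M, w ∈ z ↔ w = x ∨ w = y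
  union : ∀ x ∈ M, ∃ z ∈ M, ∀ w ∈ M, w ∈ z ↔ ∃ y ∈ x, w ∈ y
  powerset : ∀ x ∈ M, ∃ z ∈ M, ∀ w ∈ M, w ∈ z ↔ w ⊆ x
  infinity : ∃ z ∈ M, ∅ ∈ z ∧ ∀ x ∈ z, insert x x ∈ z
  separation : ∀ D : Set M, Set.Definable₁ Set.univ setLang D →
    ∀ a ∈ M, ∃ b ∈ M, ∀ x : M, (x : ZFSet.{u}) ∈ b ↔ (x : ZFSet.{u}) ∈ a ∧ x ∈ D
  replacement : ∀ R : Set (M × M), Set.Definable₂ Set.univ setLang R →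
    ∀ a ∈ M, (∀ x : M, (x : ZFSet.{u}) ∈ a → ∃! y : M, (x, y) ∈ R) →
      ∃ b ∈ M, ∀ y : M, (y : ZFSet.{u}) ∈ b ↔ ∃ x : M, (x : ZFSet.{u}) ∈ a ∧ (x, y) ∈ R
  choice : ∀ a ∈ M, (∀ x ∈ a, x ≠ ∅) → (∀ x ∈ a, ∀ y ∈ a, x ≠ y → x ∩ y = ∅) →
    ∃ c ∈ M, ∀ x ∈ a, ∃! z, z ∈ x ∧ z ∈ c

/-! ### Functions as sets of ordered pairs -/

/-- The value `f(x)` of a set-theoretic function `f` at a point `x` of its domain. -/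
noncomputable def app (f x : ZFSet.{u}) : ZFSet.{u} :=
  ⋃₀ (ZFSet.sep (fun y => ZFSet.pair x y ∈ f) (⋃₀ (⋃₀ f)))

/-- The composition `g ∘ f`, as a set of ordered pairs contained in `A × C`. -/
noncomputable def comp (A C g f : ZFSet.{u}) : ZFSet.{u} :=
  ZFSet.sep (fun t => ∃ x y z, t = ZFSet.pair x z ∧ ZFSet.pair x y ∈ f ∧ ZFSet.pair y z ∈ g)
    (ZFSet.prod A C)

/-! ### Topological notions relativized to a transitive class `N`

A definition with a class argument `N` is the relativization to `N` of the usual notion, i.e. it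
says `N ⊨ ...`: unbounded quantifiers range over `N`.  Quantifiers bounded by an element of a
transitive `N`, and the set operations used below, need no relativization. -/

/-- `N ⊨ ⟨X, τ⟩` is a `T₀` topological space. -/
structure IsSpace (N : Set ZFSet.{u}) (X τ : ZFSet.{u}) : Prop where
  carrier_mem : X ∈ N
  topology_mem : τ ∈ N
  subset : ∀ O ∈ τ, O ⊆ X
  empty_open : ∅ ∈ τ
  univ_open : X ∈ τ
  inter_open : ∀ O ∈ τ, ∀ P ∈ τ, O ∩ P ∈ τ
  union_open : ∀ C ∈ N, C ⊆ τ → (⋃₀ C : ZFSet.{u}) ∈ τ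
  t0 : ∀ x ∈ X, ∀ y ∈ X, (∀ O ∈ τ, x ∈ O ↔ y ∈ O) → x = y

/-- `⟨X, τ⟩` is Hausdorff. -/
def IsHausdorff (X τ : ZFSet.{u}) : Prop :=
  ∀ x ∈ X, ∀ y ∈ X, x ≠ y → ∃ O ∈ τ, ∃ P ∈ τ, x ∈ O ∧ y ∈ P ∧ O ∩ P = ∅

/-- `⟨X, τ⟩` is regular: a point `x` and a closed set `X \ O` not containing it have disjoint open
neighborhoods. -/
def IsRegular (X τ : ZFSet.{u}) : Prop :=
  ∀ O ∈ τ, ∀ x ∈ O, ∃ P ∈ τ, ∃ Q ∈ τ, x ∈ P ∧ X \ O ⊆ Q ∧ P ∩ Q = ∅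

/-- `N ⊨ D` is finite, i.e. `D` is the image in `N` of a natural number. -/
def IsFin (N : Set ZFSet.{u}) (D : ZFSet.{u}) : Prop :=
  ∃ n ∈ ZFSet.omega.{u}, ∃ e ∈ N, ZFSet.IsFunc n D e ∧ ∀ d ∈ D, ∃ k ∈ n, app e k = d

/-- `N ⊨ ⟨X, τ⟩` is compact. -/
def IsCompactSpace (N : Set ZFSet.{u}) (X τ : ZFSet.{u}) : Prop :=
  ∀ C ∈ N, C ⊆ τ → (⋃₀ C : ZFSet.{u}) = X →
    ∃ D ∈ N, D ⊆ C ∧ IsFin N D ∧ (⋃₀ D : ZFSet.{u}) = X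

/-- `N ⊨ ⟨Y, υ⟩` is Čech complete: there is a compact Hausdorff space `⟨Z, ζ⟩` and a sequence
`g : ω → ζ` of open sets such that `Y = ⋂ₙ g(n)` and `υ` is the subspace topology on `Y`. -/
def IsCechComplete (N : Set ZFSet.{u}) (Y υ : ZFSet.{u}) : Prop :=
  IsSpace N Y υ ∧
  ∃ Z ζ : ZFSet.{u}, IsSpace N Z ζ ∧ IsHausdorff Z ζ ∧ IsCompactSpace N Z ζ ∧
    (∃ g ∈ N, ZFSet.IsFunc ZFSet.omega.{u} ζ g ∧
      ∀ z, z ∈ Y ↔ z ∈ Z ∧ ∀ n ∈ ZFSet.omega.{u}, z ∈ app g n) ∧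
    ∀ U, U ∈ υ ↔ ∃ W ∈ ζ, U = W ∩ Y

/-- `f` is a continuous open surjection from `⟨Y, υ⟩` onto `⟨X, τ⟩`. -/
structure IsOpenContinuousSurjection (Y υ X τ f : ZFSet.{u}) : Prop where
  isFunc : ZFSet.IsFunc Y X f
  surjective : ∀ x ∈ X, ∃ y ∈ Y, app f y = x
  continuous : ∀ O ∈ τ, ZFSet.sep (fun y => app f y ∈ O) Y ∈ υ
  isOpen : ∀ U ∈ υ, ZFSet.sep (fun x => ∃ y ∈ U, app f y = x) X ∈ τ

/-- `N ⊨ ⟨X, τ⟩` is an interpretable space: it is regular Hausdorff and a continuous open image of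
a Čech complete space. -/
def IsInterpretable (N : Set ZFSet.{u}) (X τ : ZFSet.{u}) : Prop :=
  IsSpace N X τ ∧ IsHausdorff X τ ∧ IsRegular X τ ∧
  ∃ Y υ : ZFSet.{u}, IsCechComplete N Y υ ∧ ∃ f ∈ N, IsOpenContinuousSurjection Y υ X τ f

/-! ### Preinterpretations and interpretations

Below, `M ⊆ N` are transitive classes and `M ⊨ ⟨X, τ⟩` is a topological space.  The definitions are
relativized to `N`, the class `M` being used as a predicate.  The case `N = Set.univ` gives the
notions in `V`. -/

/-- `N ⊨` the space `⟨Y, σ⟩` with the maps `p : X → Y` (on points) and `q : τ → σ` (on open sets)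
is a topological preinterpretation of `⟨X, τ⟩` over `M`. -/
structure IsPreinterpretation (N M : Set ZFSet.{u}) (X τ Y σ p q : ZFSet.{u}) : Prop where
  source : IsSpace M X τ
  target : IsSpace N Y σ
  points_mem : p ∈ N
  opens_mem : q ∈ N
  points_isFunc : ZFSet.IsFunc X Y p
  opens_isFunc : ZFSet.IsFunc τ σ q
  mem_iff : ∀ x ∈ X, ∀ O ∈ τ, x ∈ O ↔ app p x ∈ app q O
  map_inter : ∀ O ∈ τ, ∀ P ∈ τ, app q (O ∩ P) = app q O ∩ app q P
  map_union : ∀ C ∈ M, C ⊆ τ → ∀ y, y ∈ app q (⋃₀ C) ↔ ∃ O ∈ C, y ∈ app q O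
  map_empty : app q ∅ = ∅
  map_univ : app q X = Y
  basis : ∀ U ∈ σ, ∀ y ∈ U, ∃ O ∈ τ, y ∈ app q O ∧ app q O ⊆ U

/-- `h : Y₀ → Y₁` is a reduction of the preinterpretation `⟨Y₀, p₀, q₀⟩` of `⟨X, τ⟩` to the
preinterpretation `⟨Y₁, p₁, q₁⟩`. -/
structure IsReduction (X τ Y₀ p₀ q₀ Y₁ p₁ q₁ h : ZFSet.{u}) : Prop where
  isFunc : ZFSet.IsFunc Y₀ Y₁ h
  comp_eq : ∀ x ∈ X, app h (app p₀ x) = app p₁ x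
  preimage_eq : ∀ O ∈ τ, ∀ y ∈ Y₀, app h y ∈ app q₁ O ↔ y ∈ app q₀ O

/-- `N ⊨` the space `⟨Y, σ⟩` with the maps `p, q` is an interpretation of `⟨X, τ⟩` over `M`: a
preinterpretation to which every preinterpretation can be reduced. -/
def IsInterpretation (N M : Set ZFSet.{u}) (X τ Y σ p q : ZFSet.{u}) : Prop :=
  IsPreinterpretation N M X τ Y σ p q ∧
  ∀ Y' σ' p' q' : ZFSet.{u}, IsPreinterpretation N M X τ Y' σ' p' q' →
    ∃ h ∈ N, IsReduction X τ Y' p' q' Y p q h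

end TopInterp

/-! A point of a preinterpretation over `M` determines the filter of those open sets whose
interpretation contains it, and this filter is completely prime for families lying in `M`.
Conversely, the completely prime filters in `N` form a preinterpretation in `N`, and reducing it to
an interpretation realizes each of them by a point (`IsInterpretation.exists_point`). So an
interpretation is the space of all such filters, and the theorem is about extending filters.

Let a point of a competing preinterpretation give the filter `F` on `X₀`. The sets `app q₀ O` with
`O ∈ F` generate a filter on `X₁`. If it is completely prime over `M₁`, it is realized by a point of
`X₂`, and sending the given point there is the reduction (`isInterpretation_comp`). Suppose
primeness fails for a cover `C ∈ M₁` of some `app q₀ O`. The open sets `P` with `app q₀ P` inside a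
member of `C` then form a family in `M₁` disjoint from `F`. If `M₁` contains a completely prime
filter containing `O` and disjoint from this family, its point in `X₁` lies in `app q₀ O` but in no
member of `C`, a contradiction (`isPrimeFilter_generated`).

Such a filter in the smaller universe comes from Čech completeness
(`exists_isPrimeFilter_of_isInterpretable`). Let `f : Y → X₀` be open, with `Y` the intersection of
open sets `g(n)` of a compact Hausdorff `Z`. In `V`, `F` yields open sets of `Z`, each with closure
inside its predecessor and inside `g(n)`, whose traces on `Y` are not covered by preimages of
finitely many forbidden sets. Well-foundedness is absolute, so `M₁` contains such a sequence too
(`exists_branch`). Zorn's lemma in `M₁` extends it to a maximal filter avoiding the ideal of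
finitely covered sets, and compactness makes the rounding of that filter completely prime
(`exists_isPrimeFilter`). A second use of absoluteness, inside `M`, shows that the new filter sees
only traces on `Y` (`IsPrimeFilter.mem_of_trace_subset`), so it can be pushed down to `X₀`. -/

namespace TopInterp

/-! ### Definability over a transitive model -/

variable {M : Set ZFSet.{u}} {n : ℕ}

/-- `φ` is definable over `(M, ∈)` with parameters. -/
def Dfn (M : Set ZFSet.{u}) {n : ℕ} (φ : (Fin n → M) → Prop) : Prop :=
  (Set.univ : Set M).Definable setLang {v | φ v}

/-- `t` is a variable or a parameter from `M`. -/
def Tm (M : Set ZFSet.{u}) {n : ℕ} (t : (Fin n → M) → ZFSet.{u}) : Prop :=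
  ∃ i : (Set.univ : Set M) ⊕ Fin n, ∀ v,
    t v = (Sum.elim (fun a : (Set.univ : Set M) => (a : M)) v i : M)

theorem Tm.var (i : Fin n) : Tm M (fun v => (v i : ZFSet.{u})) := ⟨.inr i, fun _ => rfl⟩

theorem Tm.const {c : ZFSet.{u}} (hc : c ∈ M) : Tm M (fun _ : Fin n → M => c) :=
  ⟨.inl ⟨⟨c, hc⟩, trivial⟩, fun _ => rfl⟩

theorem Tm.mem {t : (Fin n → M) → ZFSet.{u}} (ht : Tm M t) (v) : t v ∈ M := by
  obtain ⟨i, hi⟩ := ht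
  rw [hi]
  exact Subtype.coe_prop _

theorem Tm.lift {t : (Fin n → M) → ZFSet.{u}} (ht : Tm M t) :
    Tm M (fun w : Fin (n + 1) → M => t (fun i => w i.castSucc)) := by
  obtain ⟨i | i, hi⟩ := ht
  · exact ⟨.inl i, fun w => hi _⟩
  · exact ⟨.inr i.castSucc, fun w => hi _⟩

theorem Dfn.and {φ ψ : (Fin n → M) → Prop} (h : Dfn M φ) (k : Dfn M ψ) :
    Dfn M (fun v => φ v ∧ ψ v) :=
  Set.Definable.inter h k

theorem Dfn.or {φ ψ : (Fin n → M) → Prop} (h : Dfn M φ) (k : Dfn M ψ) :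
    Dfn M (fun v => φ v ∨ ψ v) :=
  Set.Definable.union h k

theorem Dfn.not {φ : (Fin n → M) → Prop} (h : Dfn M φ) : Dfn M (fun v => ¬ φ v) :=
  Set.Definable.compl h

theorem Dfn.congr {φ ψ : (Fin n → M) → Prop} (h : Dfn M φ) (k : ∀ v, ψ v ↔ φ v) : Dfn M ψ := by
  have : ψ = φ := funext fun v => propext (k v)
  rwa [this]

theorem Dfn.imp {φ ψ : (Fin n → M) → Prop} (h : Dfn M φ) (k : Dfn M ψ) :
    Dfn M (fun v => φ v → ψ v) :=
  (h.not.or k).congr fun _ => imp_iff_not_or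

theorem Dfn.iff {φ ψ : (Fin n → M) → Prop} (h : Dfn M φ) (k : Dfn M ψ) :
    Dfn M (fun v => φ v ↔ ψ v) :=
  ((h.imp k).and (k.imp h)).congr fun _ => iff_def

/-- The bound variable is the last coordinate, and quantifying it away is projection of a definable
set. The statement has this shape so that unification can assemble a definability proof along the
syntax of a formula. -/
theorem Dfn.ex {φ : (Fin n → M) → ZFSet.{u} → Prop}
    (h : Dfn M (fun w : Fin (n + 1) → M => φ (fun i => w i.castSucc) (w (Fin.last n)))) :
    Dfn M (fun v => ∃ x ∈ M, φ v x) := by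
  have := Set.Definable.image_comp h (Fin.castSucc : Fin n → Fin (n + 1))
  unfold Dfn
  convert this using 1
  ext v
  simp only [Set.mem_ofPred_eq, Set.mem_image]
  constructor
  · rintro ⟨x, hx, hφ⟩
    refine ⟨Fin.snoc (α := fun _ => M) v ⟨x, hx⟩, ?_, ?_⟩
    · simpa using hφ
    · ext i
      simp
  · rintro ⟨w, hw, rfl⟩
    exact ⟨w (Fin.last n), Subtype.coe_prop _, hw⟩

theorem Dfn.all {φ : (Fin n → M) → ZFSet.{u} → Prop}
    (h : Dfn M (fun w : Fin (n + 1) → M => φ (fun i => w i.castSucc) (w (Fin.last n)))) :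
    Dfn M (fun v => ∀ x ∈ M, φ v x) := by
  refine (Dfn.not (Dfn.ex (φ := fun v x => ¬ φ v x) (Dfn.not h))).congr fun v => ?_
  push Not
  rfl

theorem Dfn.mem {s t : (Fin n → M) → ZFSet.{u}} (hs : Tm M s) (ht : Tm M t) :
    Dfn M (fun v => s v ∈ t v) := by
  obtain ⟨i, hi⟩ := hs
  obtain ⟨j, hj⟩ := ht
  unfold Dfn
  rw [Set.definable_iff_exists_formula_sum]
  let r : setLang.Relations 2 := MemRel.mem
  refine ⟨r.formula₂ (.var i) (.var j), ?_⟩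
  ext v
  simp only [Set.mem_ofPred_eq, FirstOrder.Language.Formula.realize_rel₂,
    FirstOrder.Language.Term.realize_var, hi, hj]
  rfl

theorem Dfn.eq {s t : (Fin n → M) → ZFSet.{u}} (hs : Tm M s) (ht : Tm M t) :
    Dfn M (fun v => s v = t v) := by
  obtain ⟨i, hi⟩ := hs
  obtain ⟨j, hj⟩ := ht
  unfold Dfn
  rw [Set.definable_iff_exists_formula_sum]
  refine ⟨FirstOrder.Language.Term.equal (.var i) (.var j), ?_⟩
  ext v
  simp only [Set.mem_ofPred_eq, FirstOrder.Language.Formula.realize_equal,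
    FirstOrder.Language.Term.realize_var, hi, hj, Subtype.coe_inj]

/-! ### Closure of a transitive model under set operations, and definability of bounded formulas. -/

namespace IsTransitiveModel

variable (hM : IsTransitiveModel M)
include hM

theorem bex {φ : (Fin n → M) → ZFSet.{u} → Prop} {a : (Fin n → M) → ZFSet.{u}}
    (ha : Tm M a)
    (h : Dfn M (fun w : Fin (n + 1) → M => φ (fun i => w i.castSucc) (w (Fin.last n)))) :
    Dfn M (fun v => ∃ x ∈ a v, φ v x) := by
  refine (Dfn.ex (φ := fun v x => x ∈ a v ∧ φ v x)
    ((Dfn.mem (.var _) ha.lift).and h)).congr fun v => ?_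
  exact ⟨fun ⟨x, hx, k⟩ => ⟨x, hM.transitive _ (ha.mem v) _ hx, hx, k⟩,
    fun ⟨x, _, hx, k⟩ => ⟨x, hx, k⟩⟩

theorem ball {φ : (Fin n → M) → ZFSet.{u} → Prop} {a : (Fin n → M) → ZFSet.{u}}
    (ha : Tm M a)
    (h : Dfn M (fun w : Fin (n + 1) → M => φ (fun i => w i.castSucc) (w (Fin.last n)))) :
    Dfn M (fun v => ∀ x ∈ a v, φ v x) := by
  refine (Dfn.not (hM.bex (φ := fun v x => ¬ φ v x) ha (Dfn.not h))).congr fun v => ?_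
  push Not
  rfl

theorem subset {s t : (Fin n → M) → ZFSet.{u}} (hs : Tm M s) (ht : Tm M t) :
    Dfn M (fun v => s v ⊆ t v) :=
  (hM.ball (φ := fun v x => x ∈ t v) hs (.mem (.var _) ht.lift)).congr fun _ => Iff.rfl

theorem mem_of_mem {x y : ZFSet.{u}} (h : x ∈ y) (hy : y ∈ M) : x ∈ M := hM.transitive y hy x h

theorem upair_mem {x y : ZFSet.{u}} (hx : x ∈ M) (hy : y ∈ M) : ({x, y} : ZFSet.{u}) ∈ M := by
  obtain ⟨z, hz, h⟩ := hM.pairing x hx y hy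
  convert hz
  ext w
  rw [ZFSet.mem_pair]
  refine ⟨fun k => (h w ?_).2 k, fun k => (h w (hM.mem_of_mem k hz)).1 k⟩
  rcases k with rfl | rfl <;> assumption

theorem singleton_mem {x : ZFSet.{u}} (hx : x ∈ M) : ({x} : ZFSet.{u}) ∈ M := by
  rw [← ZFSet.pair_eq_singleton]
  exact hM.upair_mem hx hx

theorem pair_mem {x y : ZFSet.{u}} (hx : x ∈ M) (hy : y ∈ M) : ZFSet.pair x y ∈ M :=
  hM.upair_mem (hM.singleton_mem hx) (hM.upair_mem hx hy)

theorem of_pair_mem {x y z : ZFSet.{u}} (h : ZFSet.pair x y ∈ z) (hz : z ∈ M) : x ∈ M ∧ y ∈ M := by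
  have h1 : ({x, y} : ZFSet.{u}) ∈ M :=
    hM.mem_of_mem (y := ZFSet.pair x y) (by simp [ZFSet.pair]) (hM.mem_of_mem h hz)
  exact ⟨hM.mem_of_mem (by simp) h1, hM.mem_of_mem (by simp) h1⟩

theorem sUnion_mem {x : ZFSet.{u}} (hx : x ∈ M) : (⋃₀ x : ZFSet.{u}) ∈ M := by
  obtain ⟨z, hz, h⟩ := hM.union x hx
  convert hz
  ext w
  rw [ZFSet.mem_sUnion]
  refine ⟨fun k => (h w ?_).2 k, fun k => (h w (hM.mem_of_mem k hz)).1 k⟩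
  obtain ⟨y, hy, hw⟩ := k
  exact hM.mem_of_mem hw (hM.mem_of_mem hy hx)

theorem union_mem {x y : ZFSet.{u}} (hx : x ∈ M) (hy : y ∈ M) : x ∪ y ∈ M := by
  rw [← ZFSet.sUnion_pair]
  exact hM.sUnion_mem (hM.upair_mem hx hy)

theorem insert_mem {x y : ZFSet.{u}} (hx : x ∈ M) (hy : y ∈ M) : insert x y ∈ M := by
  rw [ZFSet.insert_eq]
  exact hM.union_mem (hM.singleton_mem hx) hy

theorem sep_mem {a : ZFSet.{u}} (ha : a ∈ M) {φ : ZFSet.{u} → Prop}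
    (h : Dfn M (fun v : Fin 1 → M => φ (v 0))) : ZFSet.sep φ a ∈ M := by
  obtain ⟨b, hb, k⟩ := hM.separation {x | φ x} h a ha
  convert hb
  ext x
  rw [ZFSet.mem_sep]
  exact ⟨fun hx => (k ⟨x, hM.mem_of_mem hx.1 ha⟩).2 hx, fun hx => (k ⟨x, hM.mem_of_mem hx hb⟩).1 hx⟩

theorem empty_mem : ∅ ∈ M := by
  obtain ⟨z, hz, h, -⟩ := hM.infinity
  exact hM.mem_of_mem h hz

theorem inter_mem {x y : ZFSet.{u}} (hx : x ∈ M) (hy : y ∈ M) : x ∩ y ∈ M := by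
  rw [← ZFSet.sep_mem]
  exact hM.sep_mem hx (.mem (.var _) (.const hy))

/-- The power set in the sense of `M`. -/
theorem exists_powerset {x : ZFSet.{u}} (hx : x ∈ M) :
    ∃ z ∈ M, ∀ w, w ∈ z ↔ w ∈ M ∧ w ⊆ x := by
  obtain ⟨z, hz, h⟩ := hM.powerset x hx
  exact ⟨z, hz, fun w => ⟨fun k => ⟨hM.mem_of_mem k hz, (h w (hM.mem_of_mem k hz)).1 k⟩,
    fun k => (h w k.1).2 k.2⟩⟩

/-- Kuratowski's definition is written out with quantifiers over `M`. By transitivity and closure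
under pairing, these see every element of the sets involved. -/
theorem eq_pair {r s t : (Fin n → M) → ZFSet.{u}} (hr : Tm M r) (hs : Tm M s) (ht : Tm M t) :
    Dfn M (fun v => r v = ZFSet.pair (s v) (t v)) := by
  have h : Dfn M (fun v => ∀ w ∈ M, w ∈ r v ↔
      ((∀ x ∈ M, x ∈ w ↔ x = s v) ∨ (∀ x ∈ M, x ∈ w ↔ x = s v ∨ x = t v))) :=
    .all (.iff (.mem (.var _) hr.lift) (.or
      (.all (.iff (.mem (.var _) (.var _)) (.eq (.var _) hs.lift.lift)))
      (.all (.iff (.mem (.var _) (.var _))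
        (.or (.eq (.var _) hs.lift.lift) (.eq (.var _) ht.lift.lift))))))
  refine h.congr fun v => ?_
  have hr' := hr.mem v
  have hs' := hs.mem v
  have ht' := ht.mem v
  have e1 : ∀ w ∈ M, (∀ x ∈ M, x ∈ w ↔ x = s v) ↔ w = {s v} := by
    intro w hw
    constructor
    · intro k
      ext x
      rw [ZFSet.mem_singleton]
      exact ⟨fun hx => (k x (hM.mem_of_mem hx hw)).1 hx, fun hx => (k x (hx ▸ hs')).2 hx⟩
    · rintro rfl x -
      simp
  have e2 : ∀ w ∈ M, (∀ x ∈ M, x ∈ w ↔ x = s v ∨ x = t v) ↔ w = {s v, t v} := by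
    intro w hw
    constructor
    · intro k
      ext x
      rw [ZFSet.mem_pair]
      refine ⟨fun hx => (k x (hM.mem_of_mem hx hw)).1 hx, fun hx => (k x ?_).2 hx⟩
      rcases hx with hx | hx <;> rw [hx] <;> assumption
    · rintro rfl x -
      simp
  constructor
  · intro e w hw
    rw [e1 w hw, e2 w hw, e, ZFSet.pair, ZFSet.mem_pair]
  · intro k
    ext w
    rw [ZFSet.pair, ZFSet.mem_pair]
    constructor
    · intro hw
      have hwM := hM.mem_of_mem hw hr'
      have := (k w hwM).1 hw
      rwa [e1 w hwM, e2 w hwM] at this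
    · intro hw
      have hwM : w ∈ M := by
        rcases hw with rfl | rfl
        · exact hM.singleton_mem hs'
        · exact hM.upair_mem hs' ht'
      rw [k w hwM, e1 w hwM, e2 w hwM]
      exact hw

theorem pairMem {r s t : (Fin n → M) → ZFSet.{u}} (hs : Tm M s) (ht : Tm M t) (hr : Tm M r) :
    Dfn M (fun v => ZFSet.pair (s v) (t v) ∈ r v) :=
  (hM.bex (φ := fun v x => x = ZFSet.pair (s v) (t v)) hr
    (hM.eq_pair (.var _) hs.lift ht.lift)).congr fun v => by simp

theorem eq_succ {s t : (Fin n → M) → ZFSet.{u}} (hs : Tm M s) (ht : Tm M t) :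
    Dfn M (fun v => s v = insert (t v) (t v)) := by
  have h : Dfn M (fun v => ∀ x ∈ M, x ∈ s v ↔ x = t v ∨ x ∈ t v) :=
    .all (.iff (.mem (.var _) hs.lift) (.or (.eq (.var _) ht.lift) (.mem (.var _) ht.lift)))
  refine h.congr fun v => ⟨fun e x _ => by rw [e, ZFSet.mem_insert_iff], fun k => ?_⟩
  ext x
  rw [ZFSet.mem_insert_iff]
  refine ⟨fun hx => (k x (hM.mem_of_mem hx (hs.mem v))).1 hx, fun hx => (k x ?_).2 hx⟩
  rcases hx with rfl | hx
  · exact ht.mem v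
  · exact hM.mem_of_mem hx (ht.mem v)

theorem prod_mem {x y : ZFSet.{u}} (hx : x ∈ M) (hy : y ∈ M) : ZFSet.prod x y ∈ M := by
  obtain ⟨p, hp, hp'⟩ := hM.exists_powerset (hM.union_mem hx hy)
  obtain ⟨q, hq, hq'⟩ := hM.exists_powerset hp
  have : ZFSet.prod x y = ZFSet.sep (fun w => ∃ a ∈ x, ∃ b ∈ y, w = ZFSet.pair a b) q := by
    ext w
    rw [ZFSet.mem_prod, ZFSet.mem_sep, iff_and_self]
    rintro ⟨a, ha, b, hb, rfl⟩
    have haM := hM.mem_of_mem ha hx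
    have hbM := hM.mem_of_mem hb hy
    refine (hq' _).2 ⟨hM.pair_mem haM hbM, fun z hz => ?_⟩
    rw [ZFSet.pair, ZFSet.mem_pair] at hz
    rcases hz with rfl | rfl
    · refine (hp' _).2 ⟨hM.singleton_mem haM, fun z hz => ?_⟩
      rw [ZFSet.mem_singleton] at hz
      exact ZFSet.mem_union.2 (.inl (hz ▸ ha))
    · refine (hp' _).2 ⟨hM.upair_mem haM hbM, fun z hz => ?_⟩
      rw [ZFSet.mem_pair] at hz
      rcases hz with rfl | rfl
      · exact ZFSet.mem_union.2 (.inl ha)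
      · exact ZFSet.mem_union.2 (.inr hb)
  rw [this]
  exact hM.sep_mem hq (hM.bex (.const hx) (hM.bex (.const hy)
    (hM.eq_pair (.var _) (.var _) (.var _))))

theorem exists_image {a : ZFSet.{u}} (ha : a ∈ M) {ρ : ZFSet.{u} → ZFSet.{u} → Prop}
    (h : Dfn M (fun v : Fin 2 → M => ρ (v 0) (v 1)))
    (hu : ∀ x ∈ a, ∃! y, y ∈ M ∧ ρ x y) :
    ∃ b ∈ M, ∀ y, y ∈ b ↔ ∃ x ∈ a, y ∈ M ∧ ρ x y := by
  obtain ⟨b, hb, k⟩ := hM.replacement {p | ρ p.1 p.2} h a ha (fun x hx => by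
    obtain ⟨y, hy, hy'⟩ := hu x hx
    exact ⟨⟨y, hy.1⟩, hy.2, fun z hz => Subtype.ext (hy' z ⟨z.2, hz⟩)⟩)
  refine ⟨b, hb, fun y => ⟨fun hy => ?_, fun ⟨x, hx, hy, hxy⟩ => ?_⟩⟩
  · obtain ⟨x, hx, hxy⟩ := (k ⟨y, hM.mem_of_mem hy hb⟩).1 hy
    exact ⟨x, hx, hM.mem_of_mem hy hb, hxy⟩
  · exact (k ⟨y, hy⟩).2 ⟨⟨x, hM.mem_of_mem hx ha⟩, hx, hxy⟩

theorem exists_graph {a : ZFSet.{u}} (ha : a ∈ M) {ρ : ZFSet.{u} → ZFSet.{u} → Prop}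
    (h : Dfn M (fun v : Fin 2 → M => ρ (v 0) (v 1)))
    (hu : ∀ x ∈ a, ∃! y, y ∈ M ∧ ρ x y) :
    ∃ b ∈ M, ∀ w, w ∈ b ↔ ∃ x ∈ a, ∃ y ∈ M, ρ x y ∧ w = ZFSet.pair x y := by
  have h' : Dfn M (fun v : Fin 3 → M => ρ (v 0) (v 2)) :=
    Set.Definable.preimage_comp (![0, 2] : Fin 2 → Fin 3) h
  obtain ⟨b, hb, k⟩ := hM.exists_image ha (ρ := fun x w => ∃ y ∈ M, ρ x y ∧ w = ZFSet.pair x y)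
    (.ex (.and h' (hM.eq_pair (.var _) (.var _) (.var _)))) (fun x hx => by
      obtain ⟨y, hy, hy'⟩ := hu x hx
      refine ⟨ZFSet.pair x y, ⟨hM.pair_mem (hM.mem_of_mem hx ha) hy.1, y, hy.1, hy.2, rfl⟩, ?_⟩
      rintro w ⟨-, z, hz, hz', rfl⟩
      rw [hy' z ⟨hz, hz'⟩])
  refine ⟨b, hb, fun w => (k w).trans ⟨fun ⟨x, hx, _, hw⟩ => ⟨x, hx, hw⟩, ?_⟩⟩
  rintro ⟨x, hx, y, hy, hxy, rfl⟩
  exact ⟨x, hx, hM.pair_mem (hM.mem_of_mem hx ha) hy, y, hy, hxy, rfl⟩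

theorem exists_of_finite {s : Set ZFSet.{u}} (hs : s.Finite) (hsM : s ⊆ M) :
    ∃ a ∈ M, ∀ x, x ∈ a ↔ x ∈ s := by
  induction s, hs using Set.Finite.induction_on with
  | empty => exact ⟨∅, hM.empty_mem, by simp⟩
  | @insert x s _ _ ih =>
    obtain ⟨a, ha, h⟩ := ih fun y hy => hsM (Set.mem_insert_of_mem _ hy)
    exact ⟨insert x a, hM.insert_mem (hsM (Set.mem_insert _ _)) ha, fun y => by simp [h]⟩

end IsTransitiveModel

/-- The von Neumann natural numbers. -/
noncomputable def nat : ℕ → ZFSet.{u}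
  | 0 => ∅
  | n + 1 => insert (nat n) (nat n)

theorem mem_omega_iff {x : ZFSet.{u}} : x ∈ ZFSet.omega.{u} ↔ ∃ k, x = nat k := by
  have e : ∀ k, ZFSet.mk (PSet.ofNat k) = nat k := by
    intro k
    induction k with
    | zero => rfl
    | succ k ih =>
      rw [nat, ← ih]
      rfl
  induction x using Quotient.inductionOn with | _ x => ?_
  constructor
  · rintro ⟨⟨k⟩, hk⟩
    exact ⟨k, by rw [← e]; exact ZFSet.sound hk⟩
  · rintro ⟨k, hk⟩
    exact ⟨⟨k⟩, ZFSet.exact (by rw [← ZFSet.mk_eq, hk]; exact (e k).symm)⟩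

theorem nat_mem_omega (k : ℕ) : nat k ∈ ZFSet.omega.{u} := mem_omega_iff.2 ⟨k, rfl⟩

theorem mem_nat_iff {k : ℕ} {x : ZFSet.{u}} : x ∈ nat k ↔ ∃ j < k, x = nat j := by
  induction k with
  | zero => simp [nat]
  | succ k ih =>
    rw [nat, ZFSet.mem_insert_iff, ih]
    constructor
    · rintro (rfl | ⟨j, hj, rfl⟩)
      · exact ⟨k, by omega, rfl⟩
      · exact ⟨j, by omega, rfl⟩
    · rintro ⟨j, hj, rfl⟩
      rcases Nat.lt_succ_iff_lt_or_eq.1 hj with h | rfl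
      · exact .inr ⟨j, h, rfl⟩
      · exact .inl rfl

theorem nat_injective : Function.Injective nat.{u} := by
  intro i j h
  by_contra hne
  rcases lt_or_gt_of_ne hne with k | k
  · have := mem_nat_iff.2 ⟨i, k, rfl⟩
    exact ZFSet.mem_irrefl (nat j) (by rwa [h] at this)
  · have := mem_nat_iff.2 ⟨j, k, rfl⟩
    exact ZFSet.mem_irrefl (nat i) (by rwa [← h] at this)

namespace IsTransitiveModel

variable (hM : IsTransitiveModel M)
include hM

theorem nat_mem (k : ℕ) : nat k ∈ M := by
  induction k with
  | zero => exact hM.empty_mem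
  | succ k ih => exact hM.insert_mem ih ih

/-- The set given by Infinity may be too large, so it is cut down to the elements of all inductive
sets of `M`. An ∈-minimal element `x` of the result that is not a natural number could be removed
and leave an inductive set in `M`, contradicting the choice of the elements. -/
theorem omega_mem : ZFSet.omega.{u} ∈ M := by
  obtain ⟨z, hz, h0, hs⟩ := hM.infinity
  let φ : ZFSet.{u} → Prop := fun x => ∀ b ∈ M, ∅ ∈ b → (∀ y ∈ M, y ∈ b →
    ∃ y' ∈ b, y' = insert y y) → x ∈ b
  have hφ : Dfn M (fun v : Fin 1 → M => φ (v 0)) :=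
    .all (.imp (.mem (.const hM.empty_mem) (.var _)) (.imp (.all (.imp (.mem (.var _) (.var _))
      (hM.bex (.var _) (hM.eq_succ (.var _) (.var _))))) (.mem (.var _) (.var _))))
  set w := ZFSet.sep φ z with hw
  have hwM : w ∈ M := hM.sep_mem hz hφ
  have hnat : ∀ k, nat k ∈ w := by
    intro k
    refine ZFSet.mem_sep.2 ⟨?_, fun b hb h0 hs => ?_⟩
    · induction k with
      | zero => exact h0
      | succ k ih => exact hs _ ih
    · induction k with
      | zero => exact h0
      | succ k ih =>
        obtain ⟨y', hy', rfl⟩ := hs _ (hM.nat_mem k) ih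
        exact hy'
  have : ZFSet.omega.{u} = w := by
    ext x
    rw [mem_omega_iff]
    refine ⟨fun ⟨k, hk⟩ => hk ▸ hnat k, ?_⟩
    induction x using ZFSet.inductionOn with | _ x ih => ?_
    intro hx
    by_contra hne
    have hb : ZFSet.sep (fun y => y ≠ x) w ∈ M :=
      hM.sep_mem hwM (.not (.eq (.var _) (.const (hM.mem_of_mem hx hwM))))
    have := (ZFSet.mem_sep.1 hx).2 _ hb
      (ZFSet.mem_sep.2 ⟨hnat 0, fun e => hne ⟨0, e.symm⟩⟩) (fun y _ hy => by
        obtain ⟨hyw, hyx⟩ := ZFSet.mem_sep.1 hy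
        obtain ⟨hyz, hyφ⟩ := ZFSet.mem_sep.1 hyw
        refine ⟨_, ZFSet.mem_sep.2 ⟨ZFSet.mem_sep.2 ⟨hs y hyz, fun b hb h0 hs' => ?_⟩, ?_⟩, rfl⟩
        · obtain ⟨y', hy', rfl⟩ := hs' y (hM.mem_of_mem hyz hz) (hyφ b hb h0 hs')
          exact hy'
        · rintro rfl
          obtain ⟨k, rfl⟩ := ih y (ZFSet.mem_insert _ _) hyw
          exact hne ⟨k + 1, rfl⟩)
    exact (ZFSet.mem_sep.1 this).2 rfl
  rw [this]
  exact hwM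

end IsTransitiveModel

/-- Lets the results about models `M ⊆ N` be applied with `N` the whole universe. -/
theorem isTransitiveModel_univ : IsTransitiveModel (Set.univ : Set ZFSet.{u}) where
  transitive _ _ _ _ := trivial
  pairing x _ y _ := ⟨{x, y}, trivial, fun w _ => ZFSet.mem_pair⟩
  union x _ := ⟨⋃₀ x, trivial, fun w _ => ZFSet.mem_sUnion⟩
  powerset x _ := ⟨x.powerset, trivial, fun w _ => ZFSet.mem_powerset⟩
  infinity := ⟨ZFSet.omega, trivial, ZFSet.omega_zero, fun _ => ZFSet.omega_succ⟩
  separation D _ a _ := ⟨ZFSet.sep (fun x => ⟨x, trivial⟩ ∈ D) a, trivial, fun x => ZFSet.mem_sep⟩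
  replacement R _ a _ h := by
    choose f hf hf' using h
    refine ⟨ZFSet.range (fun x : Shrink.{u} a => (f ⟨(equivShrink a).symm x, trivial⟩
      ((equivShrink a).symm x).2 : ZFSet.{u})), trivial, fun y => ?_⟩
    rw [ZFSet.mem_range]
    constructor
    · rintro ⟨x, hx⟩
      have e : y = f ⟨(equivShrink a).symm x, trivial⟩ ((equivShrink a).symm x).2 :=
        Subtype.ext hx.symm
      exact ⟨⟨(equivShrink a).symm x, trivial⟩, ((equivShrink a).symm x).2, e ▸ hf _ _⟩
    · rintro ⟨x, hx, hxy⟩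
      refine ⟨equivShrink a ⟨x, hx⟩, ?_⟩
      rw [hf' x hx y hxy]
      simp
  choice a _ hne hd := by
    choose f hf using fun x : a => (ZFSet.nonempty_def x.1).1
      ((ZFSet.eq_empty_or_nonempty x.1).resolve_left (hne x.1 x.2))
    refine ⟨ZFSet.range (fun x : Shrink.{u} a => f ((equivShrink a).symm x)), trivial,
      fun x hx => ?_⟩
    refine ⟨f ⟨x, hx⟩, ⟨hf ⟨x, hx⟩, ZFSet.mem_range.2 ⟨equivShrink a ⟨x, hx⟩, by simp⟩⟩, ?_⟩
    rintro z ⟨hz, hz'⟩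
    obtain ⟨i, rfl⟩ := ZFSet.mem_range.1 hz'
    have : ((equivShrink a).symm i : ZFSet.{u}) = x := by
      by_contra h
      have := hd _ ((equivShrink a).symm i).2 x hx h
      exact ZFSet.notMem_empty _ (this ▸ ZFSet.mem_inter.2 ⟨hf _, hz⟩)
    congr 1
    exact Subtype.ext this

end TopInterp

namespace TopInterp

variable {M : Set ZFSet.{u}}

/-! ### Descending sequences of a relation in a transitive model -/

/-- `g` is a partial collapsing function of `R`: its domain is closed under `R`-successors and
`g(x) = {g(x') : x R x'}`. -/
def IsCollapse (M : Set ZFSet.{u}) (R g : ZFSet.{u}) : Prop :=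
  ∀ x ∈ M, ∀ y ∈ M, ZFSet.pair x y ∈ g →
    (∀ z ∈ M, z ∈ y ↔ ∃ x' ∈ M, ZFSet.pair x x' ∈ R ∧ ZFSet.pair x' z ∈ g) ∧
    (∀ x' ∈ M, ZFSet.pair x x' ∈ R → ∃ z ∈ M, ZFSet.pair x' z ∈ g)

/-- ∈-induction on the value: elements of either value are values at successors, where the two
collapses agree. Uniqueness allows all partial collapses in `M` to be glued. -/
theorem IsCollapse.unique (hM : IsTransitiveModel M) {R g g' : ZFSet.{u}}
    (hgM : g ∈ M) (hgM' : g' ∈ M) (hg : IsCollapse M R g)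
    (hg' : IsCollapse M R g') {x y y' : ZFSet.{u}}
    (h : ZFSet.pair x y ∈ g) (h' : ZFSet.pair x y' ∈ g') : y = y' := by
  induction y using ZFSet.inductionOn generalizing x y' with | _ y ih => ?_
  obtain ⟨hx, hy⟩ := hM.of_pair_mem h hgM
  obtain ⟨-, hy'⟩ := hM.of_pair_mem h' hgM'
  obtain ⟨h1, h2⟩ := hg x hx y hy h
  obtain ⟨h1', h2'⟩ := hg' x hx y' hy' h'
  ext z
  constructor
  · intro hz
    obtain ⟨x', hx', hxx', hz'⟩ := (h1 z (hM.mem_of_mem hz hy)).1 hz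
    obtain ⟨w, hw, hw'⟩ := h2' x' hx' hxx'
    obtain rfl := ih z hz hz' hw'
    exact (h1' z hw).2 ⟨x', hx', hxx', hw'⟩
  · intro hz
    obtain ⟨x', hx', hxx', hz'⟩ := (h1' z (hM.mem_of_mem hz hy')).1 hz
    obtain ⟨w, hw, hw'⟩ := h2 x' hx' hxx'
    have hwy := (h1 w hw).2 ⟨x', hx', hxx', hw'⟩
    obtain rfl := ih w hwy hw' hz'
    exact hwy

namespace IsTransitiveModel

variable (hM : IsTransitiveModel M)
include hM

/-- The sections of `R` over distinct points are disjoint sets of pairs, so the axiom of choice for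
disjoint families applies to them. -/
theorem exists_choice {a R : ZFSet.{u}} (ha : a ∈ M) (hR : R ∈ M)
    (h : ∀ x ∈ a, ∃ y, ZFSet.pair x y ∈ R) :
    ∃ c ∈ M, ∀ x ∈ a, ∃ y, ZFSet.pair x y ∈ R ∧ ∀ z, ZFSet.pair x z ∈ c ↔ z = y := by
  let ρ : ZFSet.{u} → ZFSet.{u} → Prop :=
    fun x w => ∀ u ∈ M, u ∈ w ↔ u ∈ R ∧ ∃ y ∈ M, u = ZFSet.pair x y
  have hρ : Dfn M (fun v : Fin 2 → M => ρ (v 0) (v 1)) :=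
    .all (.iff (.mem (.var _) (.var _)) (.and (.mem (.var _) (.const hR))
      (.ex (hM.eq_pair (.var _) (.var _) (.var _)))))
  have hρ' : ∀ x w, w ∈ M → ρ x w → ∀ u, u ∈ w ↔ u ∈ R ∧ ∃ y, u = ZFSet.pair x y := by
    intro x w hw h u
    constructor
    · intro hu
      obtain ⟨h1, y, -, h2⟩ := (h u (hM.mem_of_mem hu hw)).1 hu
      exact ⟨h1, y, h2⟩
    · rintro ⟨h1, y, rfl⟩
      exact (h _ (hM.mem_of_mem h1 hR)).2 ⟨h1, y, (hM.of_pair_mem h1 hR).2, rfl⟩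
  obtain ⟨b, hb, hb'⟩ := hM.exists_image ha hρ (by
    intro x hx
    have hxM := hM.mem_of_mem hx ha
    refine ⟨ZFSet.sep (fun u => ∃ y ∈ M, u = ZFSet.pair x y) R, ⟨hM.sep_mem hR
      (.ex (hM.eq_pair (.var _) (.const hxM) (.var _))), fun u _ => ZFSet.mem_sep⟩, ?_⟩
    rintro w ⟨hw, hw'⟩
    ext u
    rw [ZFSet.mem_sep]
    exact ⟨fun hu => (hw' u (hM.mem_of_mem hu hw)).1 hu,
      fun hu => (hw' u (hM.mem_of_mem hu.1 hR)).2 hu⟩)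
  obtain ⟨c, hc, hc'⟩ := hM.choice b hb
    (by
      rintro w hw rfl
      obtain ⟨x, hx, hwM, hw'⟩ := (hb' _).1 hw
      obtain ⟨y, hy⟩ := h x hx
      exact ZFSet.notMem_empty _ ((hρ' x _ hwM hw' _).2 ⟨hy, y, rfl⟩))
    (by
      intro w hw w' hw' hne
      obtain ⟨x, hx, hwM, hwx⟩ := (hb' _).1 hw
      obtain ⟨x', hx', hwM', hwx'⟩ := (hb' _).1 hw'
      rw [ZFSet.eq_empty]
      intro u hu
      rw [ZFSet.mem_inter, hρ' x w hwM hwx, hρ' x' w' hwM' hwx'] at hu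
      obtain ⟨⟨-, y, rfl⟩, -, y', e⟩ := hu
      obtain ⟨rfl, rfl⟩ := ZFSet.pair_inj.1 e
      refine hne ?_
      ext u
      rw [hρ' x w hwM hwx, hρ' x w' hwM' hwx'])
  -- The choice set may contain pairs outside `R`; intersecting with `R` leaves exactly one pair
  -- over each `x ∈ a`.
  refine ⟨c ∩ R, hM.inter_mem hc hR, fun x hx => ?_⟩
  obtain ⟨y, hy⟩ := h x hx
  obtain ⟨w, hw, hw'⟩ : ∃ w ∈ b, w ∈ M ∧ ρ x w := by
    have hxM := hM.mem_of_mem hx ha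
    have h1 : ZFSet.sep (fun u => ∃ y ∈ M, u = ZFSet.pair x y) R ∈ M := hM.sep_mem hR
      (.ex (hM.eq_pair (.var _) (.const hxM) (.var _)))
    have h2 : ρ x (ZFSet.sep (fun u => ∃ y ∈ M, u = ZFSet.pair x y) R) := fun u _ => ZFSet.mem_sep
    exact ⟨_, (hb' _).2 ⟨x, hx, h1, h2⟩, h1, h2⟩
  obtain ⟨z, ⟨hz, hzc⟩, hzu⟩ := hc' w hw
  obtain ⟨hzR, y, rfl⟩ := (hρ' x w hw'.1 hw'.2 z).1 hz
  refine ⟨y, hzR, fun z => ?_⟩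
  rw [ZFSet.mem_inter]
  constructor
  · rintro ⟨h1, h2⟩
    exact (ZFSet.pair_inj.1 (hzu (ZFSet.pair x z) ⟨(hρ' x w hw'.1 hw'.2 _).2 ⟨h2, z, rfl⟩, h1⟩)).2
  · rintro rfl
    exact ⟨hzc, hzR⟩

theorem isCollapse_dfn {n : ℕ} {r g : (Fin n → M) → ZFSet.{u}} (hr : Tm M r) (hg : Tm M g) :
    Dfn M (fun v => IsCollapse M (r v) (g v)) :=
  .all (.all (.imp (hM.pairMem (.var _) (.var _) hg.lift.lift) (.and
    (.all (.iff (.mem (.var _) (.var _)) (.ex (.and (hM.pairMem (.var _) (.var _) hr.lift.lift.lift.lift)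
      (hM.pairMem (.var _) (.var _) hg.lift.lift.lift.lift)))))
    (.all (.imp (hM.pairMem (.var _) (.var _) hr.lift.lift.lift)
      (.ex (hM.pairMem (.var _) (.var _) hg.lift.lift.lift.lift)))))))

/-- A relation in `M` with an infinite descending sequence in `V` has, in `M`, a set without
terminal elements containing the first term of the sequence. -/
theorem exists_pruned {S R : ZFSet.{u}} (hS : S ∈ M) (hR : R ∈ M)
    (hRS : ∀ x y, ZFSet.pair x y ∈ R → x ∈ S ∧ y ∈ S) (s : ℕ → ZFSet.{u})
    (hs : ∀ k, ZFSet.pair (s k) (s (k + 1)) ∈ R) :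
    ∃ A ∈ M, A ⊆ S ∧ s 0 ∈ A ∧ ∀ x ∈ A, ∃ y ∈ A, ZFSet.pair x y ∈ R := by
  -- `φ x y` says that a partial collapse in `M` sends `x` to `y`. The set `B` of collapsible points
  -- is the well-founded part of `R` as `M` sees it, and its complement in `S` is the required set.
  let φ : ZFSet.{u} → ZFSet.{u} → Prop :=
    fun x y => ∃ g ∈ M, IsCollapse M R g ∧ ZFSet.pair x y ∈ g
  have hφ : Dfn M (fun v : Fin 2 → M => φ (v 0) (v 1)) :=
    .ex (.and (hM.isCollapse_dfn (.const hR) (.var _)) (hM.pairMem (.var _) (.var _) (.var _)))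
  have hφM : ∀ x y, φ x y → x ∈ M ∧ y ∈ M := fun x y ⟨g, hg, _, h⟩ => hM.of_pair_mem h hg
  have hφu : ∀ x y y', φ x y → φ x y' → y = y' := by
    rintro x y y' ⟨g, hg, hgc, h⟩ ⟨g', hg', hgc', h'⟩
    exact hgc.unique hM hg hg' hgc' h h'
  set B := ZFSet.sep (fun x => ∃ y ∈ M, φ x y) S with hB
  have hBM : B ∈ M := hM.sep_mem hS (.ex hφ)
  obtain ⟨f, hf, hf'⟩ := hM.exists_graph hBM hφ (by
    intro x hx
    obtain ⟨-, y, hy, hxy⟩ := ZFSet.mem_sep.1 hx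
    exact ⟨y, ⟨hy, hxy⟩, fun z hz => hφu x _ _ hz.2 hxy⟩)
  have hf'' : ∀ x y, ZFSet.pair x y ∈ f ↔ x ∈ S ∧ φ x y := by
    intro x y
    rw [hf']
    constructor
    · rintro ⟨x', hx', y', hy', h, e⟩
      obtain ⟨rfl, rfl⟩ := ZFSet.pair_inj.1 e
      exact ⟨(ZFSet.mem_sep.1 hx').1, h⟩
    · rintro ⟨hx, h⟩
      exact ⟨x, ZFSet.mem_sep.2 ⟨hx, y, (hφM x y h).2, h⟩, y, (hφM x y h).2, h, rfl⟩
  have hmemB : ∀ x, x ∈ B ↔ ∃ y ∈ M, ZFSet.pair x y ∈ f := by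
    intro x
    simp only [hf'', hB, ZFSet.mem_sep]
    constructor
    · rintro ⟨h1, y, h2, h3⟩
      exact ⟨y, h2, h1, h3⟩
    · rintro ⟨y, h2, h1, h3⟩
      exact ⟨h1, y, h2, h3⟩
  have hfc : IsCollapse M R f := by
    intro x hx y hy hxy
    obtain ⟨hxS, g, hg, hgc, h⟩ := (hf'' x y).1 hxy
    obtain ⟨h1, h2⟩ := hgc x hx y hy h
    constructor
    · intro z hz
      rw [h1 z hz]
      constructor
      · rintro ⟨x', hx', hxx', hz'⟩
        exact ⟨x', hx', hxx', (hf'' _ _).2 ⟨(hRS _ _ hxx').2, g, hg, hgc, hz'⟩⟩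
      · rintro ⟨x', hx', hxx', hz'⟩
        obtain ⟨w, hw, hw'⟩ := h2 x' hx' hxx'
        obtain rfl := hφu x' w z ⟨g, hg, hgc, hw'⟩ ((hf'' _ _).1 hz').2
        exact ⟨x', hx', hxx', hw'⟩
    · intro x' hx' hxx'
      obtain ⟨w, hw, hw'⟩ := h2 x' hx' hxx'
      exact ⟨w, hw, (hf'' _ _).2 ⟨(hRS _ _ hxx').2, g, hg, hgc, hw'⟩⟩
  refine ⟨ZFSet.sep (fun x => ¬ x ∈ B) S, hM.sep_mem hS (.not (.mem (.var _) (.const hBM))),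
    ZFSet.sep_subset, ?_, ?_⟩
  · refine ZFSet.mem_sep.2 ⟨(hRS _ _ (hs 0)).1, fun h => ?_⟩
    -- A collapse defined along the sequence would take an infinite ∈-descending sequence of values.
    have key : ∀ y k, ZFSet.pair (s k) y ∉ f := by
      intro y
      induction y using ZFSet.inductionOn with | _ y ih => ?_
      intro k hk
      obtain ⟨hx, hy⟩ := hM.of_pair_mem hk hf
      obtain ⟨h1, h2⟩ := hfc _ hx y hy hk
      have hsM := (hM.of_pair_mem (hs k) hR).2
      obtain ⟨z, hz, hz'⟩ := h2 _ hsM (hs k)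
      exact ih z ((h1 z hz).2 ⟨_, hsM, hs k, hz'⟩) _ hz'
    obtain ⟨y, -, hy⟩ := (hmemB _).1 h
    exact key y 0 hy
  · intro x hx
    obtain ⟨hxS, hxB⟩ := ZFSet.mem_sep.1 hx
    by_contra! hcon
    have hch : ∀ x', ZFSet.pair x x' ∈ R → x' ∈ B := by
      intro x' hx'
      by_contra hB'
      exact hcon x' (ZFSet.mem_sep.2 ⟨(hRS _ _ hx').2, hB'⟩) hx'
    have hxM := hM.mem_of_mem hxS hS
    -- If all successors of `x` were collapsible, `y` would be the value at `x`, and adding the pair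
    -- to `f` would collapse `x` as well.
    set y := ZFSet.sep (fun z => ∃ x' ∈ M, ZFSet.pair x x' ∈ R ∧ ZFSet.pair x' z ∈ f) (⋃₀ (⋃₀ f))
      with hy
    have hyM : y ∈ M := hM.sep_mem (hM.sUnion_mem (hM.sUnion_mem hf))
      (.ex (.and (hM.pairMem (.const hxM) (.var _) (.const hR))
        (hM.pairMem (.var _) (.var _) (.const hf))))
    have hymem : ∀ z, z ∈ y ↔ ∃ x' ∈ M, ZFSet.pair x x' ∈ R ∧ ZFSet.pair x' z ∈ f := by
      intro z
      rw [hy, ZFSet.mem_sep, and_iff_right_iff_imp]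
      rintro ⟨x', -, -, h⟩
      exact ZFSet.mem_sUnion_of_mem (z := {x', z}) (by simp)
        (ZFSet.mem_sUnion_of_mem (z := ZFSet.pair x' z) (by simp [ZFSet.pair]) h)
    have hpf : ∀ x' z, ZFSet.pair x' z ∈ insert (ZFSet.pair x y) f ↔
        (x' = x ∧ z = y) ∨ ZFSet.pair x' z ∈ f := by
      intro x' z
      rw [ZFSet.mem_insert_iff, ZFSet.pair_inj]
    -- The new pair changes no value at a successor of `x` or of a point of `B`: such successors lie
    -- in `B`, and `x` does not.
    have hsucc : ∀ x₁ x₂ z, (x₁ = x ∨ x₁ ∈ B) → ZFSet.pair x₁ x₂ ∈ R →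
        (ZFSet.pair x₂ z ∈ insert (ZFSet.pair x y) f ↔ ZFSet.pair x₂ z ∈ f) := by
      intro x₁ x₂ z h1 h2
      rw [hpf, or_iff_right]
      rintro ⟨rfl, -⟩
      apply hxB
      rcases h1 with rfl | h1
      · exact hch _ h2
      · obtain ⟨y₁, hy₁, h1⟩ := (hmemB _).1 h1
        rw [hmemB]
        exact (hfc _ (hM.of_pair_mem h1 hf).1 _ hy₁ h1).2 _ hxM h2
    refine hxB (ZFSet.mem_sep.2 ⟨hxS, y, hyM, insert (ZFSet.pair x y) f,
      hM.insert_mem (hM.pair_mem hxM hyM) hf, ?_, ZFSet.mem_insert _ _⟩)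
    intro x₁ hx₁ y₁ hy₁ h1
    rw [hpf] at h1
    rcases h1 with ⟨rfl, rfl⟩ | h1
    · constructor
      · intro z hz
        rw [hymem]
        exact exists_congr fun x' => and_congr_right fun _ => and_congr_right fun h =>
          (hsucc _ x' z (.inl rfl) h).symm
      · intro x' _ h
        obtain ⟨z, hz, hz'⟩ := (hmemB _).1 (hch x' h)
        exact ⟨z, hz, ZFSet.mem_insert_of_mem _ hz'⟩
    · have hB₁ : x₁ ∈ B := (hmemB _).2 ⟨y₁, hy₁, h1⟩
      obtain ⟨h2, h3⟩ := hfc _ hx₁ _ hy₁ h1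
      constructor
      · intro z hz
        rw [h2 z hz]
        exact exists_congr fun x' => and_congr_right fun _ => and_congr_right fun h =>
          (hsucc _ x' z (.inr hB₁) h).symm
      · intro x' hx' h
        obtain ⟨z, hz, hz'⟩ := h3 x' hx' h
        exact ⟨z, hz, ZFSet.mem_insert_of_mem _ hz'⟩

/-- The range of a sequence obtained by iterating a function of `M` is in `M`. -/
theorem exists_range_iterate {a c : ZFSet.{u}} (ha : a ∈ M) (hc : c ∈ M) {t : ℕ → ZFSet.{u}}
    (hta : ∀ k, t k ∈ a) (htc : ∀ k y, ZFSet.pair (t k) y ∈ c ↔ y = t (k + 1)) :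
    ∃ b ∈ M, ∀ x, x ∈ b ↔ ∃ k, x = t k := by
  have htM : ∀ k, t k ∈ M := fun k => hM.mem_of_mem (hta k) ha
  -- Finite approximations make the range definable: `e` consists of pairs of an index and a value,
  -- each either initial or obtained by `c` from another pair of `e`. It need not be a function,
  -- since induction on the index forces the value.
  let φ : ZFSet.{u} → Prop := fun x => ∃ e ∈ M, ∃ k ∈ ZFSet.omega.{u}, ZFSet.pair k x ∈ e ∧
    ∀ k ∈ ZFSet.omega.{u}, ∀ y ∈ M, ZFSet.pair k y ∈ e → (k = ∅ ∧ y = t 0) ∨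
      ∃ k' ∈ ZFSet.omega.{u}, ∃ y' ∈ M, ZFSet.pair k' y' ∈ e ∧ k = insert k' k' ∧
        ZFSet.pair y' y ∈ c
  have hφ : Dfn M (fun v : Fin 1 → M => φ (v 0)) :=
    .ex (hM.bex (.const hM.omega_mem) (.and (hM.pairMem (.var _) (.var _) (.var _))
      (hM.ball (.const hM.omega_mem) (.all (.imp (hM.pairMem (.var _) (.var _) (.var _))
        (.or (.and (.eq (.var _) (.const hM.empty_mem)) (.eq (.var _) (.const (htM 0))))
        (hM.bex (.const hM.omega_mem) (.ex (.and (hM.pairMem (.var _) (.var _) (.var _))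
          (.and (hM.eq_succ (.var _) (.var _)) (hM.pairMem (.var _) (.var _) (.const hc)))))))))))) 
  refine ⟨ZFSet.sep φ a, hM.sep_mem ha hφ, fun x => ?_⟩
  rw [ZFSet.mem_sep]
  constructor
  · rintro ⟨hx, e, he, k, hk, hkx, h⟩
    obtain ⟨k, rfl⟩ := mem_omega_iff.1 hk
    refine ⟨k, ?_⟩
    have hxM := hM.mem_of_mem hx ha
    clear hx
    induction k generalizing x with
    | zero =>
      rcases h _ hk x hxM hkx with ⟨-, h⟩ | ⟨k', -, y', -, -, h, -⟩
      · exact h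
      · exact absurd (h ▸ ZFSet.mem_insert k' k' : k' ∈ nat 0) (ZFSet.notMem_empty _)
    | succ k ih =>
      rcases h _ hk x hxM hkx with ⟨h, -⟩ | ⟨k', hk', y', hy', h1, h2, h3⟩
      · have h' : nat k ∈ nat (k + 1) := ZFSet.mem_insert (nat k) (nat k)
        exact absurd h' (h ▸ ZFSet.notMem_empty _)
      · obtain ⟨j, rfl⟩ := mem_omega_iff.1 hk'
        have : k + 1 = j + 1 := nat_injective h2
        obtain rfl : k = j := by omega
        obtain rfl := ih _ hk' h1 hy'
        exact (htc _ _).1 h3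
  · rintro ⟨k, rfl⟩
    obtain ⟨e, he, he'⟩ := hM.exists_of_finite
      (s := (fun j => ZFSet.pair (nat j) (t j)) '' Set.Iic k) ((Set.finite_Iic k).image _) (by
        rintro _ ⟨j, -, rfl⟩
        exact hM.pair_mem (hM.nat_mem j) (htM j))
    refine ⟨hta k, e, he, nat k, nat_mem_omega k, (he' _).2 ⟨k, by simp, rfl⟩, ?_⟩
    rintro _ - y - hy
    obtain ⟨j, hj, e1⟩ := (he' _).1 hy
    obtain ⟨rfl, rfl⟩ := ZFSet.pair_inj.1 e1
    cases j with
    | zero => exact .inl ⟨rfl, rfl⟩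
    | succ j =>
      refine .inr ⟨nat j, nat_mem_omega j, t j, htM j, (he' _).2 ⟨j, ?_, rfl⟩, rfl, (htc _ _).2 rfl⟩
      simp only [Set.mem_Iic] at hj ⊢
      omega

/-- If a relation in `M` has an infinite descending sequence in `V`, it has one with the same
first term in `M`. -/
theorem exists_branch {S R : ZFSet.{u}} (hS : S ∈ M) (hR : R ∈ M)
    (hRS : ∀ x y, ZFSet.pair x y ∈ R → x ∈ S ∧ y ∈ S) (s : ℕ → ZFSet.{u})
    (hs : ∀ k, ZFSet.pair (s k) (s (k + 1)) ∈ R) :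
    ∃ t : ℕ → ZFSet.{u}, t 0 = s 0 ∧ (∀ k, ZFSet.pair (t k) (t (k + 1)) ∈ R) ∧
      ∃ b ∈ M, ∀ x, x ∈ b ↔ ∃ k, x = t k := by
  obtain ⟨A, hA, hAS, h0, hpr⟩ := hM.exists_pruned hS hR hRS s hs
  -- Inside the set without terminal elements, a choice function from `M` can be iterated forever.
  -- The iteration takes place in `V`, but its range is in `M`.
  have hR' : ZFSet.sep (fun w => ∃ x ∈ A, ∃ y ∈ A, w = ZFSet.pair x y) R ∈ M :=
    hM.sep_mem hR (hM.bex (.const hA) (hM.bex (.const hA) (hM.eq_pair (.var _) (.var _) (.var _))))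
  have hmem : ∀ x y, ZFSet.pair x y ∈ ZFSet.sep (fun w => ∃ x ∈ A, ∃ y ∈ A, w = ZFSet.pair x y) R ↔
      ZFSet.pair x y ∈ R ∧ x ∈ A ∧ y ∈ A := by
    intro x y
    rw [ZFSet.mem_sep]
    constructor
    · rintro ⟨h, x', hx', y', hy', e⟩
      obtain ⟨rfl, rfl⟩ := ZFSet.pair_inj.1 e
      exact ⟨h, hx', hy'⟩
    · rintro ⟨h, hx, hy⟩
      exact ⟨h, x, hx, y, hy, rfl⟩
  obtain ⟨c, hc, hc'⟩ := hM.exists_choice hA hR' (by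
    intro x hx
    obtain ⟨y, hy, hxy⟩ := hpr x hx
    exact ⟨y, (hmem _ _).2 ⟨hxy, hx, hy⟩⟩)
  choose! F hF hF' using hc'
  let t : ℕ → ZFSet.{u} := fun k => F^[k] (s 0)
  have htA : ∀ k, t k ∈ A := by
    intro k
    induction k with
    | zero => exact h0
    | succ k ih =>
      simp only [t, Function.iterate_succ_apply'] at ih ⊢
      exact ((hmem _ _).1 (hF _ ih)).2.2
  have hts : ∀ k, t (k + 1) = F (t k) := fun k => by simp only [t, Function.iterate_succ_apply']
  refine ⟨t, rfl, fun k => ?_, hM.exists_range_iterate hA hc htA fun k y => ?_⟩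
  · rw [hts]
    exact ((hmem _ _).1 (hF _ (htA k))).1
  · rw [hts]
    exact hF' _ (htA k) y

end IsTransitiveModel

end TopInterp

namespace TopInterp

variable {M : Set ZFSet.{u}}

/-! ### Zorn's lemma in a transitive model -/

/-- `K` is linearly ordered by inclusion. -/
def IsChainSet (K : ZFSet.{u}) : Prop := ∀ x ∈ K, ∀ y ∈ K, x ⊆ y ∨ y ⊆ x

namespace IsTransitiveModel

variable (hM : IsTransitiveModel M)
include hM

theorem sUnion_mem_dfn {n : ℕ} {s t : (Fin n → M) → ZFSet.{u}} (hs : Tm M s) (ht : Tm M t) :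
    Dfn M (fun v => (⋃₀ (s v) : ZFSet.{u}) ∈ t v) := by
  have h : Dfn M (fun v => ∃ u ∈ t v, ∀ z ∈ M, z ∈ u ↔ ∃ w ∈ s v, z ∈ w) :=
    hM.bex ht (.all (.iff (.mem (.var _) (.var _)) (hM.bex hs.lift.lift (.mem (.var _) (.var _)))))
  refine h.congr fun v => ⟨fun k => ⟨_, k, fun z _ => ZFSet.mem_sUnion⟩, ?_⟩
  rintro ⟨u, hu, k⟩
  convert hu
  ext z
  rw [ZFSet.mem_sUnion]
  have huM := hM.mem_of_mem hu (ht.mem v)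
  refine ⟨?_, fun hz => (k z (hM.mem_of_mem hz huM)).1 hz⟩
  rintro ⟨w, hw, hz⟩
  exact (k z (hM.mem_of_mem hz (hM.mem_of_mem hw (hs.mem v)))).2 ⟨w, hw, hz⟩

theorem isChainSet_dfn {n : ℕ} {s : (Fin n → M) → ZFSet.{u}} (hs : Tm M s) :
    Dfn M (fun v => IsChainSet (s v)) :=
  hM.ball hs (hM.ball hs.lift (.or (hM.subset (.var _) (.var _)) (hM.subset (.var _) (.var _))))

/-- The Bourbaki–Witt fixed point theorem in `M`, for families of sets ordered by inclusion. -/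
theorem exists_fixedPoint {𝓕 c F₀ : ZFSet.{u}} (h𝓕 : 𝓕 ∈ M) (hcM : c ∈ M) (hF₀ : F₀ ∈ 𝓕)
    (hch : ∀ K ∈ M, K ⊆ 𝓕 → IsChainSet K → (∃ x, x ∈ K) → (⋃₀ K : ZFSet.{u}) ∈ 𝓕)
    (s : ZFSet.{u} → ZFSet.{u}) (hs𝓕 : ∀ x ∈ 𝓕, s x ∈ 𝓕)
    (hsc : ∀ x ∈ 𝓕, ∀ y, ZFSet.pair x y ∈ c ↔ y = s x) (hsub : ∀ x ∈ 𝓕, x ⊆ s x) :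
    ∃ x ∈ 𝓕, s x = x := by
  have hFM := hM.mem_of_mem hF₀ h𝓕
  -- Families closed under `s` and under unions of nonempty chains. The least one, `K₀`, turns out
  -- to be a chain, so its union belongs to it and is fixed by `s`.
  let Cl : ZFSet.{u} → Prop := fun B => F₀ ∈ B ∧
    (∀ x ∈ B, x ∈ 𝓕 → ∀ y ∈ M, ZFSet.pair x y ∈ c → y ∈ B) ∧
    ∀ K ∈ M, K ⊆ 𝓕 → K ⊆ B → IsChainSet K → (∃ x ∈ M, x ∈ K) → (⋃₀ K : ZFSet.{u}) ∈ B
  let φ : ZFSet.{u} → Prop := fun x => ∀ B ∈ M, Cl B → x ∈ B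
  have hφ : Dfn M (fun v : Fin 1 → M => φ (v 0)) :=
    .all (.imp (.and (.mem (.const hFM) (.var _)) (.and
      (hM.ball (.var _) (.imp (.mem (.var _) (.const h𝓕)) (.all (.imp
        (hM.pairMem (.var _) (.var _) (.const hcM)) (.mem (.var _) (.var _))))))
      (.all (.imp (hM.subset (.var _) (.const h𝓕)) (.imp (hM.subset (.var _) (.var _))
        (.imp (hM.isChainSet_dfn (.var _)) (.imp (.ex (.mem (.var _) (.var _)))
          (hM.sUnion_mem_dfn (.var _) (.var _))))))))) (.mem (.var _) (.var _)))
  set K₀ := ZFSet.sep φ 𝓕 with hK₀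
  have hK₀M : K₀ ∈ M := hM.sep_mem h𝓕 hφ
  have hK₀𝓕 : K₀ ⊆ 𝓕 := ZFSet.sep_subset
  have k1 : F₀ ∈ K₀ := ZFSet.mem_sep.2 ⟨hF₀, fun B _ hB => hB.1⟩
  have k2 : ∀ x ∈ K₀, s x ∈ K₀ := by
    intro x hx
    obtain ⟨hx𝓕, hx⟩ := ZFSet.mem_sep.1 hx
    exact ZFSet.mem_sep.2 ⟨hs𝓕 x hx𝓕, fun B hBM hB => hB.2.1 x (hx B hBM hB) hx𝓕 _
      (hM.mem_of_mem (hs𝓕 x hx𝓕) h𝓕) ((hsc x hx𝓕 _).2 rfl)⟩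
  have k3 : ∀ K ∈ M, K ⊆ K₀ → IsChainSet K → (∃ x, x ∈ K) → (⋃₀ K : ZFSet.{u}) ∈ K₀ := by
    intro K hK hKK hKc ⟨x, hx⟩
    have hK𝓕 : K ⊆ 𝓕 := fun x hx => hK₀𝓕 (hKK hx)
    refine ZFSet.mem_sep.2 ⟨hch K hK hK𝓕 hKc ⟨x, hx⟩, fun B hBM hB => hB.2.2 K hK hK𝓕 ?_ hKc
      ⟨x, hM.mem_of_mem hx hK, hx⟩⟩
    exact fun x hx => (ZFSet.mem_sep.1 (hKK hx)).2 B hBM hB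
  -- Minimality of `K₀` is only among families in `M`, so induction is available for definable
  -- properties alone.
  have ind : ∀ ψ : ZFSet.{u} → Prop, Dfn M (fun v : Fin 1 → M => ψ (v 0)) → ψ F₀ →
      (∀ x ∈ K₀, ψ x → ψ (s x)) →
      (∀ K ∈ M, K ⊆ K₀ → IsChainSet K → (∃ x, x ∈ K) → (∀ x ∈ K, ψ x) → ψ (⋃₀ K : ZFSet.{u})) →
      ∀ x ∈ K₀, ψ x := by
    intro ψ hψ h1 h2 h3 x hx
    refine (ZFSet.mem_sep.1 ((ZFSet.mem_sep.1 hx).2 (ZFSet.sep ψ K₀) (hM.sep_mem hK₀M hψ)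
      ⟨ZFSet.mem_sep.2 ⟨k1, h1⟩, ?_, ?_⟩)).2
    · intro x hx hx𝓕 y _ hxy
      obtain ⟨hx, hψx⟩ := ZFSet.mem_sep.1 hx
      rw [(hsc x hx𝓕 y).1 hxy]
      exact ZFSet.mem_sep.2 ⟨k2 x hx, h2 x hx hψx⟩
    · rintro K hK hK𝓕 hKB hKc ⟨x, -, hx⟩
      have hKK : K ⊆ K₀ := fun x hx => (ZFSet.mem_sep.1 (hKB hx)).1
      exact ZFSet.mem_sep.2 ⟨k3 K hK hKK hKc ⟨x, hx⟩, h3 K hK hKK hKc ⟨x, hx⟩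
        fun x hx => (ZFSet.mem_sep.1 (hKB hx)).2⟩
  have hsM : ∀ x ∈ K₀, s x ∈ M := fun x hx => hM.mem_of_mem (k2 x hx) hK₀M
  have least : ∀ x ∈ K₀, F₀ ⊆ x := by
    refine ind _ (hM.subset (.const hFM) (.var _)) (fun _ h => h)
      (fun x hx h z hz => hsub x (hK₀𝓕 hx) (h hz)) ?_
    rintro K - - - ⟨x, hx⟩ h z hz
    exact ZFSet.mem_sUnion_of_mem (h x hx hz) hx
  -- The extreme elements of the Bourbaki–Witt argument: an extreme element is comparable with all
  -- of `K₀`, and every element is extreme.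
  let Ext : ZFSet.{u} → Prop := fun e => ∀ x ∈ K₀, x ⊆ e → x ≠ e → s x ⊆ e
  have step1 : ∀ e ∈ K₀, Ext e → ∀ x ∈ K₀, x ⊆ e ∨ s e ⊆ x := by
    intro e he hext
    refine ind _ (.or (hM.subset (.var _) (.const (hM.mem_of_mem he hK₀M)))
      (hM.subset (.const (hsM e he)) (.var _))) (.inl (least e he)) ?_ ?_
    · rintro x hx (h | h)
      · by_cases hxe : x = e
        · exact .inr (by rw [hxe])
        · exact .inl (hext x hx h hxe)
      · exact .inr fun z hz => hsub x (hK₀𝓕 hx) (h hz)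
    · intro K hK hKK hKc hne h
      by_cases hall : ∀ x ∈ K, x ⊆ e
      · refine .inl fun z hz => ?_
        obtain ⟨x, hx, hzx⟩ := ZFSet.mem_sUnion.1 hz
        exact hall x hx hzx
      · push Not at hall
        obtain ⟨x, hx, hxe⟩ := hall
        exact .inr fun z hz => ZFSet.mem_sUnion_of_mem ((h x hx).resolve_left hxe hz) hx
  have step2 : ∀ e ∈ K₀, Ext e := by
    have hExt : Dfn M (fun v : Fin 1 → M => Ext (v 0)) := by
      have : Dfn M (fun v : Fin 1 → M => ∀ x ∈ K₀, x ⊆ (v 0 : ZFSet.{u}) → ¬ x = v 0 →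
          ∀ y ∈ M, ZFSet.pair x y ∈ c → y ⊆ v 0) :=
        hM.ball (.const hK₀M) (.imp (hM.subset (.var _) (.var _)) (.imp (.not (.eq (.var _) (.var _)))
          (.all (.imp (hM.pairMem (.var _) (.var _) (.const hcM)) (hM.subset (.var _) (.var _))))))
      refine this.congr fun v => forall₂_congr fun x hx => imp_congr_right fun _ =>
        imp_congr_right fun _ => ?_
      refine ⟨fun h y _ hxy => ?_, fun h => h _ (hsM x hx) ((hsc x (hK₀𝓕 hx) _).2 rfl)⟩
      rwa [(hsc x (hK₀𝓕 hx) y).1 hxy]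
    refine ind _ hExt ?_ ?_ ?_
    · intro x hx h hne
      exact absurd (subset_antisymm h (least x hx)) hne
    · intro e he hext x hx h hne
      rcases step1 e he hext x hx with h' | h'
      · by_cases hxe : x = e
        · rw [hxe]
        · exact fun z hz => hsub e (hK₀𝓕 he) (hext x hx h' hxe hz)
      · exact absurd (subset_antisymm h h') hne
    · intro K hK hKK hKc hne h x hx hxK hxne
      by_cases hall : ∀ k ∈ K, s k ⊆ x
      · refine absurd (subset_antisymm hxK fun z hz => ?_) hxne
        obtain ⟨k, hk, hz⟩ := ZFSet.mem_sUnion.1 hz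
        exact hall k hk (hsub k (hK₀𝓕 (hKK hk)) hz)
      · push Not at hall
        obtain ⟨k, hk, hkx⟩ := hall
        have hxk := (step1 k (hKK hk) (h k hk) x hx).resolve_right hkx
        by_cases e : x = k
        · subst e
          exact (step1 x hx (h x hk) _ (k3 K hK hKK hKc hne)).resolve_left fun h' =>
            hxne (subset_antisymm hxK h')
        · exact fun z hz => ZFSet.mem_sUnion_of_mem (h k hk x hx hxk e hz) hk
  have hchain : IsChainSet K₀ := by
    intro x hx e he
    rcases step1 e he (step2 e he) x hx with h | h
    · exact .inl h
    · exact .inr fun z hz => h (hsub e (hK₀𝓕 he) hz)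
  have htop := k3 K₀ hK₀M (fun _ h => h) hchain ⟨_, k1⟩
  exact ⟨_, hK₀𝓕 htop, subset_antisymm
    (fun z hz => ZFSet.mem_sUnion_of_mem hz (k2 _ htop)) (hsub _ (hK₀𝓕 htop))⟩

/-- Zorn's lemma in `M`, for families of sets ordered by inclusion. -/
theorem exists_maximal {𝓕 F₀ : ZFSet.{u}} (h𝓕 : 𝓕 ∈ M) (hF₀ : F₀ ∈ 𝓕)
    (hch : ∀ K ∈ M, K ⊆ 𝓕 → IsChainSet K → (∃ x, x ∈ K) → (⋃₀ K : ZFSet.{u}) ∈ 𝓕) :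
    ∃ G ∈ 𝓕, ∀ G' ∈ 𝓕, G ⊆ G' → G' = G := by
  by_contra! hcon
  have hR : ZFSet.sep (fun w => ∃ x ∈ 𝓕, ∃ y ∈ 𝓕, x ⊆ y ∧ (¬ y = x) ∧ w = ZFSet.pair x y)
      (ZFSet.prod 𝓕 𝓕) ∈ M :=
    hM.sep_mem (hM.prod_mem h𝓕 h𝓕) (hM.bex (.const h𝓕) (hM.bex (.const h𝓕)
      (.and (hM.subset (.var _) (.var _)) (.and (.not (.eq (.var _) (.var _)))
        (hM.eq_pair (.var _) (.var _) (.var _))))))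
  obtain ⟨c, hc, hc'⟩ := hM.exists_choice h𝓕 hR (by
    intro x hx
    obtain ⟨y, hy, hxy, hne⟩ := hcon x hx
    exact ⟨y, ZFSet.mem_sep.2 ⟨ZFSet.pair_mem_prod.2 ⟨hx, hy⟩, x, hx, y, hy, hxy, hne, rfl⟩⟩)
  choose! s hs hsc using hc'
  have hs' : ∀ x ∈ 𝓕, s x ∈ 𝓕 ∧ x ⊆ s x ∧ s x ≠ x := by
    intro x hx
    obtain ⟨-, x', hx', y', hy', h1, h2, e⟩ := ZFSet.mem_sep.1 (hs x hx)
    obtain ⟨rfl, rfl⟩ := ZFSet.pair_inj.1 e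
    exact ⟨hy', h1, h2⟩
  obtain ⟨x, hx, e⟩ := hM.exists_fixedPoint h𝓕 hc hF₀ hch s (fun x hx => (hs' x hx).1) hsc
    fun x hx => (hs' x hx).2.1
  exact (hs' x hx).2.2 e

end IsTransitiveModel

end TopInterp

namespace TopInterp

variable {M N : Set ZFSet.{u}}

/-! ### Functions -/

section Functions

variable {A B f x y : ZFSet.{u}}

/-- For a function the set of values over which `app` takes the union is the singleton `{y}`. -/
theorem app_eq (hf : ZFSet.IsFunc A B f) (h : ZFSet.pair x y ∈ f) : app f x = y := by
  have hx := (ZFSet.pair_mem_prod.1 (hf.1 h)).1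
  obtain ⟨z, hz, hz'⟩ := hf.2 x hx
  have key : ∀ w, ZFSet.pair x w ∈ f ↔ w = y := fun w =>
    ⟨fun hw => (hz' w hw).trans (hz' y h).symm, fun e => e ▸ h⟩
  ext w
  simp only [app, ZFSet.mem_sUnion, ZFSet.mem_sep, key]
  constructor
  · rintro ⟨_, ⟨-, rfl⟩, hw⟩
    exact hw
  · intro hw
    exact ⟨y, ⟨⟨{x, y}, ⟨ZFSet.pair x y, h, by simp [ZFSet.pair]⟩, by simp⟩, rfl⟩, hw⟩

theorem pair_mem_iff (hf : ZFSet.IsFunc A B f) (hx : x ∈ A) :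
    ZFSet.pair x y ∈ f ↔ y = app f x := by
  refine ⟨fun h => (app_eq hf h).symm, ?_⟩
  rintro rfl
  obtain ⟨z, hz, -⟩ := hf.2 x hx
  rwa [app_eq hf hz]

theorem app_mem (hf : ZFSet.IsFunc A B f) (hx : x ∈ A) : app f x ∈ B :=
  (ZFSet.pair_mem_prod.1 (hf.1 ((pair_mem_iff hf hx).2 rfl))).2

end Functions

/-! ### Completely prime filters of open sets -/

/-- `F` is a filter of open sets of `⟨X, τ⟩` which is completely prime with respect to the
families of open sets in `M`. -/
structure IsPrimeFilter (M : Set ZFSet.{u}) (X τ F : ZFSet.{u}) : Prop where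
  subset : F ⊆ τ
  univ_mem : X ∈ F
  inter_mem : ∀ O ∈ F, ∀ P ∈ F, O ∩ P ∈ F
  mem_of_subset : ∀ O ∈ F, ∀ P ∈ τ, O ⊆ P → P ∈ F
  prime : ∀ C ∈ M, C ⊆ τ → (⋃₀ C : ZFSet.{u}) ∈ F → ∃ O ∈ C, O ∈ F

theorem IsSpace.union_mem (hM : IsTransitiveModel M) {X τ : ZFSet.{u}} (hX : IsSpace M X τ)
    {O P : ZFSet.{u}} (hO : O ∈ τ) (hP : P ∈ τ) : O ∪ P ∈ τ := by
  rw [← ZFSet.sUnion_pair]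
  refine hX.union_open _ (hM.upair_mem (hM.mem_of_mem hO hX.topology_mem)
    (hM.mem_of_mem hP hX.topology_mem)) fun W hW => ?_
  rcases ZFSet.mem_pair.1 hW with rfl | rfl <;> assumption

/-! ### Compact Hausdorff spaces -/

/-- The closure of `P` is contained in `O`. -/
def WellInside (Z ζ P O : ZFSet.{u}) : Prop :=
  ∃ Q ∈ ζ, (∀ z ∈ P, ¬ z ∈ Q) ∧ ∀ z ∈ Z, z ∈ O ∨ z ∈ Q

section Compact

variable {Z ζ : ZFSet.{u}}

theorem WellInside.mono {P P' O O' : ZFSet.{u}} (h : WellInside Z ζ P O) (hP : P' ⊆ P)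
    (hO : O ⊆ O') : WellInside Z ζ P' O' := by
  obtain ⟨Q, hQ, h1, h2⟩ := h
  exact ⟨Q, hQ, fun z hz => h1 z (hP hz), fun z hz => (h2 z hz).imp_left fun h => hO h⟩

theorem WellInside.subset {P O : ZFSet.{u}} (h : WellInside Z ζ P O) (hP : P ⊆ Z) : P ⊆ O := by
  obtain ⟨Q, hQ, h1, h2⟩ := h
  exact fun z hz => (h2 z (hP hz)).resolve_right (h1 z hz)

theorem WellInside.inter (hM : IsTransitiveModel M) (hZ : IsSpace M Z ζ) {P P' O O' : ZFSet.{u}}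
    (h : WellInside Z ζ P O) (h' : WellInside Z ζ P' O') : WellInside Z ζ (P ∩ P') (O ∩ O') := by
  obtain ⟨Q, hQ, h1, h2⟩ := h
  obtain ⟨Q', hQ', h1', h2'⟩ := h'
  refine ⟨Q ∪ Q', hZ.union_mem hM hQ hQ', fun z hz k => ?_, fun z hz => ?_⟩
  · rw [ZFSet.mem_inter] at hz
    rcases ZFSet.mem_union.1 k with k | k
    · exact h1 z hz.1 k
    · exact h1' z hz.2 k
  · rw [ZFSet.mem_inter, ZFSet.mem_union]
    have := h2 z hz
    have := h2' z hz
    tauto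

theorem IsTransitiveModel.wellInside_dfn (hM : IsTransitiveModel M) (hZ : Z ∈ M) (hζ : ζ ∈ M)
    {n : ℕ} {s t : (Fin n → M) → ZFSet.{u}} (hs : Tm M s) (ht : Tm M t) :
    Dfn M (fun v => WellInside Z ζ (s v) (t v)) :=
  hM.bex (.const hζ) (.and (hM.ball hs.lift (.not (.mem (.var _) (.var _))))
    (hM.ball (.const hZ) (.or (.mem (.var _) ht.lift.lift) (.mem (.var _) (.var _)))))

/-- The natural numbers of `M` are the true ones, so finiteness in the sense of `M` is genuine
finiteness and induction on the subcover can be done in `V`. -/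
theorem exists_finite_subcover (hc : IsCompactSpace M Z ζ) (hZ : IsSpace M Z ζ) {C : ZFSet.{u}}
    (hC : C ∈ M) (hCζ : C ⊆ ζ) (hcov : ∀ z ∈ Z, ∃ O ∈ C, z ∈ O) :
    ∃ D : Set ZFSet.{u}, D.Finite ∧ (∀ O ∈ D, O ∈ C) ∧ ∀ z ∈ Z, ∃ O ∈ D, z ∈ O := by
  obtain ⟨D, -, hDC, ⟨n, hn, e, -, -, he⟩, hD⟩ := hc C hC hCζ (by
    ext z
    rw [ZFSet.mem_sUnion]
    exact ⟨fun ⟨O, hO, hz⟩ => hZ.subset O (hCζ hO) hz, hcov z⟩)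
  refine ⟨{O | O ∈ D}, ?_, fun O hO => hDC hO, fun z hz => ?_⟩
  · obtain ⟨k, rfl⟩ := mem_omega_iff.1 hn
    refine ((Set.finite_Iio k).image (fun j => app e (nat j))).subset fun O hO => ?_
    obtain ⟨i, hi, rfl⟩ := he O hO
    obtain ⟨j, hj, rfl⟩ := mem_nat_iff.1 hi
    exact ⟨j, hj, rfl⟩
  · rw [← hD, ZFSet.mem_sUnion] at hz
    exact hz

variable (hM : IsTransitiveModel M) (hZ : IsSpace M Z ζ) (hH : IsHausdorff Z ζ)
  (hc : IsCompactSpace M Z ζ)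

include hM hZ hc

/-- The closure of `P` is compact: adjoin to `C` the open set `Q` witnessing `WellInside`, take a
finite subcover of `Z`, and discard `Q`, which misses `P`. -/
theorem exists_finite_cover_of_wellInside {P O C : ZFSet.{u}} (h : WellInside Z ζ P O) (hP : P ⊆ Z)
    (hC : C ∈ M) (hCζ : C ⊆ ζ) (hcov : ∀ z ∈ O, ∃ W ∈ C, z ∈ W) :
    ∃ D : Set ZFSet.{u}, D.Finite ∧ (∀ W ∈ D, W ∈ C) ∧ ∀ z ∈ P, ∃ W ∈ D, z ∈ W := by
  obtain ⟨Q, hQ, h1, h2⟩ := h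
  obtain ⟨D, hD, hDC, hDcov⟩ := exists_finite_subcover hc hZ (C := insert Q C)
    (hM.insert_mem (hM.mem_of_mem hQ hZ.topology_mem) hC)
    (fun W hW => by
      rcases ZFSet.mem_insert_iff.1 hW with rfl | hW
      · exact hQ
      · exact hCζ hW)
    (fun z hz => by
      rcases h2 z hz with h | h
      · obtain ⟨W, hW, hz⟩ := hcov z h
        exact ⟨W, ZFSet.mem_insert_of_mem _ hW, hz⟩
      · exact ⟨Q, ZFSet.mem_insert _ _, h⟩)
  refine ⟨D ∩ {W | W ∈ C}, hD.inter_of_left _, fun W hW => hW.2, fun z hz => ?_⟩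
  obtain ⟨W, hW, hzW⟩ := hDcov z (hP hz)
  refine ⟨W, ⟨hW, (ZFSet.mem_insert_iff.1 (hDC W hW)).resolve_left ?_⟩, hzW⟩
  rintro rfl
  exact h1 z hz hzW

include hH

/-- Regularity of compact Hausdorff spaces. The space is covered by `O` and the open sets missing
some neighborhood of `x`; finitely many of the latter are united, and their neighborhoods
intersected. -/
theorem exists_mem_wellInside {O x : ZFSet.{u}} (hO : O ∈ ζ) (hx : x ∈ O) :
    ∃ P ∈ ζ, x ∈ P ∧ WellInside Z ζ P O := by
  have hxZ := hZ.subset O hO hx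
  have hOM := hM.mem_of_mem hO hZ.topology_mem
  obtain ⟨D, hD, hDC, hDcov⟩ := exists_finite_subcover hc hZ
    (C := ZFSet.sep (fun V => V = O ∨ ∃ U ∈ ζ, x ∈ U ∧ ∀ z ∈ U, ¬ z ∈ V) ζ)
    (hM.sep_mem hZ.topology_mem (.or (.eq (.var _) (.const hOM))
      (hM.bex (.const hZ.topology_mem) (.and (.mem (.const (hM.mem_of_mem hx hOM)) (.var _))
        (hM.ball (.var _) (.not (.mem (.var _) (.var _))))))))
    ZFSet.sep_subset
    (fun z hz => by
      by_cases hzO : z ∈ O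
      · exact ⟨O, ZFSet.mem_sep.2 ⟨hO, .inl rfl⟩, hzO⟩
      · obtain ⟨U, hU, V, hV, h1, h2, h3⟩ := hH x hxZ z hz (by rintro rfl; exact hzO hx)
        exact ⟨V, ZFSet.mem_sep.2 ⟨hV, .inr ⟨U, hU, h1, fun w hw hw' =>
          ZFSet.notMem_empty w (h3 ▸ ZFSet.mem_inter.2 ⟨hw, hw'⟩)⟩⟩, h2⟩)
  have key : ∃ P ∈ ζ, x ∈ P ∧ ∃ Q ∈ ζ, (∀ z ∈ P, ¬ z ∈ Q) ∧ ∀ V ∈ D, V = O ∨ V ⊆ Q := by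
    clear hDcov
    induction D, hD using Set.Finite.induction_on with
    | empty => exact ⟨Z, hZ.univ_open, hxZ, ∅, hZ.empty_open, by simp, by simp⟩
    | @insert V D _ _ ih =>
      obtain ⟨P, hP, hxP, Q, hQ, h1, h2⟩ := ih fun V hV => hDC V (Set.mem_insert_of_mem _ hV)
      obtain ⟨hV, rfl | ⟨U, hU, hxU, hUV⟩⟩ := ZFSet.mem_sep.1 (hDC V (Set.mem_insert _ _))
      · refine ⟨P, hP, hxP, Q, hQ, h1, fun W hW => ?_⟩
        rcases hW with rfl | hW
        · exact .inl rfl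
        · exact h2 W hW
      · refine ⟨P ∩ U, hZ.inter_open _ hP _ hU, ZFSet.mem_inter.2 ⟨hxP, hxU⟩, Q ∪ V,
          hZ.union_mem hM hQ hV, fun z hz hz' => ?_, fun W hW => ?_⟩
        · rw [ZFSet.mem_inter] at hz
          rcases ZFSet.mem_union.1 hz' with hz' | hz'
          · exact h1 z hz.1 hz'
          · exact hUV z hz.2 hz'
        · rcases hW with rfl | hW
          · exact .inr fun z hz => ZFSet.mem_union.2 (.inr hz)
          · exact (h2 W hW).imp_right fun h z hz => ZFSet.mem_union.2 (.inl (h hz))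
  obtain ⟨P, hP, hxP, Q, hQ, h1, h2⟩ := key
  refine ⟨P, hP, hxP, Q, hQ, h1, fun z hz => ?_⟩
  obtain ⟨V, hV, hzV⟩ := hDcov z hz
  rcases h2 V hV with rfl | h
  · exact .inl hzV
  · exact .inr (h hzV)

/-- By regularity `O` is the union of the open sets well inside it, and this family is in `M`. -/
theorem IsPrimeFilter.exists_wellInside {F O : ZFSet.{u}} (hF : IsPrimeFilter M Z ζ F)
    (hO : O ∈ F) : ∃ P ∈ F, WellInside Z ζ P O := by
  have hOζ := hF.subset hO
  obtain ⟨P, hP, hPF⟩ := hF.prime (ZFSet.sep (fun P => WellInside Z ζ P O) ζ)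
    (hM.sep_mem hZ.topology_mem (hM.wellInside_dfn hZ.carrier_mem hZ.topology_mem (.var _)
      (.const (hM.mem_of_mem hOζ hZ.topology_mem)))) ZFSet.sep_subset (by
        convert hO
        ext z
        rw [ZFSet.mem_sUnion]
        constructor
        · rintro ⟨P, hP, hz⟩
          obtain ⟨hP, h⟩ := ZFSet.mem_sep.1 hP
          exact h.subset (hZ.subset P hP) hz
        · intro hz
          obtain ⟨P, hP, hzP, h⟩ := exists_mem_wellInside hM hZ hH hc hOζ hz
          exact ⟨P, ZFSet.mem_sep.2 ⟨hP, h⟩, hzP⟩)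
  exact ⟨P, hPF, (ZFSet.mem_sep.1 hP).2⟩

end Compact

/-! ### Shrinking sequences of open sets -/

/-- `s` is a sequence in `ζ` which avoids `I`, with the closure of `s (k + 1)` contained in `s k`
and in `g(k)`. -/
structure IsShrinking (Z ζ g I : ZFSet.{u}) (s : ℕ → ZFSet.{u}) : Prop where
  mem : ∀ k, s k ∈ ζ
  notMem : ∀ k, ¬ s k ∈ I
  wellInside : ∀ k, WellInside Z ζ (s (k + 1)) (s k)
  wellInside_app : ∀ k, WellInside Z ζ (s (k + 1)) (app g (nat k))

section Shrinking

variable {Z ζ g I : ZFSet.{u}}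

theorem IsShrinking.antitone {s : ℕ → ZFSet.{u}} (hs : IsShrinking Z ζ g I s)
    (hζ : ∀ O ∈ ζ, O ⊆ Z) {i j : ℕ} (hij : i ≤ j) : s j ⊆ s i := by
  induction j, hij using Nat.le_induction with
  | base => exact fun _ h => h
  | succ j _ ih => exact fun z hz => ih ((hs.wellInside j).subset (hζ _ (hs.mem _)) hz)

/-- Absoluteness of well-foundedness, applied to one-step extension of pairs of an index and an open
set. The index is carried along because the step at `k` refers to `g(k)`. -/
theorem IsTransitiveModel.exists_isShrinking (hN : IsTransitiveModel N) (hZ : Z ∈ N) (hζ : ζ ∈ N)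
    (hg : g ∈ N) (hgf : ZFSet.IsFunc ZFSet.omega.{u} ζ g) (hI : I ∈ N) {s : ℕ → ZFSet.{u}}
    (hs : IsShrinking Z ζ g I s) :
    ∃ t, IsShrinking Z ζ g I t ∧ t 0 = s 0 ∧ ∃ b ∈ N, ∀ x, x ∈ b ↔ ∃ k, x = t k := by
  have hω := hN.omega_mem
  have hS := hN.prod_mem hω hζ
  let φ : ZFSet.{u} → Prop := fun w => ∃ k ∈ ZFSet.omega.{u}, ∃ k' ∈ ZFSet.omega.{u}, ∃ P ∈ ζ,
    ∃ P' ∈ ζ, ∃ G ∈ ζ, ∃ a ∈ N, ∃ b ∈ N, a = ZFSet.pair k P ∧ b = ZFSet.pair k' P' ∧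
      w = ZFSet.pair a b ∧ k' = insert k k ∧ ZFSet.pair k G ∈ g ∧ ¬ P ∈ I ∧ ¬ P' ∈ I ∧
      WellInside Z ζ P' P ∧ WellInside Z ζ P' G
  have hφ : Dfn N (fun v : Fin 1 → N => φ (v 0)) :=
    hN.bex (.const hω) (hN.bex (.const hω) (hN.bex (.const hζ) (hN.bex (.const hζ)
      (hN.bex (.const hζ) (.ex (.ex (.and (hN.eq_pair (.var _) (.var _) (.var _))
      (.and (hN.eq_pair (.var _) (.var _) (.var _)) (.and (hN.eq_pair (.var _) (.var _) (.var _))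
      (.and (hN.eq_succ (.var _) (.var _)) (.and (hN.pairMem (.var _) (.var _) (.const hg))
      (.and (.not (.mem (.var _) (.const hI))) (.and (.not (.mem (.var _) (.const hI)))
      (.and (hN.wellInside_dfn hZ hζ (.var _) (.var _))
        (hN.wellInside_dfn hZ hζ (.var _) (.var _))))))))))))))))
  set R := ZFSet.sep φ (ZFSet.prod (ZFSet.prod ZFSet.omega ζ) (ZFSet.prod ZFSet.omega ζ)) with hRdef
  have hR : R ∈ N := hN.sep_mem (hN.prod_mem hS hS) hφ
  have hRS : ∀ x y, ZFSet.pair x y ∈ R →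
      x ∈ ZFSet.prod ZFSet.omega ζ ∧ y ∈ ZFSet.prod ZFSet.omega ζ := fun x y h =>
    ZFSet.pair_mem_prod.1 (ZFSet.mem_sep.1 h).1
  have hRiff : ∀ k P y, ZFSet.pair (ZFSet.pair (nat k) P) y ∈ R ↔
      ∃ P', y = ZFSet.pair (nat (k + 1)) P' ∧
      P ∈ ζ ∧ P' ∈ ζ ∧ ¬ P ∈ I ∧ ¬ P' ∈ I ∧ WellInside Z ζ P' P ∧
      WellInside Z ζ P' (app g (nat k)) := by
    intro k P y
    have hgk : ∀ G, ZFSet.pair (nat k) G ∈ g ↔ G = app g (nat k) := fun G =>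
      pair_mem_iff hgf (nat_mem_omega k)
    constructor
    · intro h
      obtain ⟨-, k₁, hk₁, k', hk', P₁, hP₁, P', hP', G, hG, _, -, _, -, rfl, rfl, e, rfl, h1, h2, h3,
        h4, h5⟩ := ZFSet.mem_sep.1 h
      obtain ⟨e', rfl⟩ := ZFSet.pair_inj.1 e
      obtain ⟨rfl, rfl⟩ := ZFSet.pair_inj.1 e'
      rw [(hgk G).1 h1] at h5
      exact ⟨P', rfl, hP₁, hP', h2, h3, h4, h5⟩
    · rintro ⟨P', rfl, h1, h2, h3, h4, h5, h6⟩
      have n1 := nat_mem_omega.{u} k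
      have n2 := nat_mem_omega.{u} (k + 1)
      exact ZFSet.mem_sep.2 ⟨ZFSet.pair_mem_prod.2 ⟨ZFSet.pair_mem_prod.2 ⟨n1, h1⟩,
        ZFSet.pair_mem_prod.2 ⟨n2, h2⟩⟩, nat k, n1, nat (k + 1), n2, P, h1, P', h2, app g (nat k),
        app_mem hgf n1, _, hN.pair_mem (hN.nat_mem k) (hN.mem_of_mem h1 hζ), _,
        hN.pair_mem (hN.nat_mem (k + 1)) (hN.mem_of_mem h2 hζ), rfl, rfl, rfl, rfl,
        (hgk _).2 rfl, h3, h4, h5, h6⟩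
  obtain ⟨t, ht0, ht, b, hb, hbt⟩ := hN.exists_branch hS hR hRS
    (fun k => ZFSet.pair (nat k) (s k)) (fun k => (hRiff _ _ _).2 ⟨s (k + 1), rfl, hs.mem k,
      hs.mem (k + 1), hs.notMem k, hs.notMem (k + 1), hs.wellInside k, hs.wellInside_app k⟩)
  -- The branch starts at index `0` and each step raises the index by one, so its `k`-th entry
  -- carries index `k`.
  have hform : ∀ k, ∃ P, t k = ZFSet.pair (nat k) P := by
    intro k
    induction k with
    | zero => exact ⟨_, ht0⟩
    | succ k ih =>
      obtain ⟨P, hP⟩ := ih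
      have := ht k
      rw [hP, hRiff] at this
      obtain ⟨P', h, -⟩ := this
      exact ⟨P', h⟩
  choose p hp using hform
  have hp' : ∀ k, p k ∈ ζ ∧ p (k + 1) ∈ ζ ∧ ¬ p k ∈ I ∧ ¬ p (k + 1) ∈ I ∧
      WellInside Z ζ (p (k + 1)) (p k) ∧ WellInside Z ζ (p (k + 1)) (app g (nat k)) := by
    intro k
    have := ht k
    rw [hp k, hp (k + 1), hRiff] at this
    obtain ⟨P', e, h⟩ := this
    obtain ⟨-, rfl⟩ := ZFSet.pair_inj.1 e
    exact h
  refine ⟨p, ⟨fun k => (hp' k).1, fun k => (hp' k).2.2.1, fun k => (hp' k).2.2.2.2.1,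
    fun k => (hp' k).2.2.2.2.2⟩, ?_, ZFSet.sep (fun P => ∃ k ∈ ZFSet.omega.{u}, ∃ a ∈ b,
      a = ZFSet.pair k P) ζ, hN.sep_mem hζ (hN.bex (.const hω) (hN.bex (.const hb)
        (hN.eq_pair (.var _) (.var _) (.var _)))), fun x => ?_⟩
  · rw [hp 0] at ht0
    exact (ZFSet.pair_inj.1 ht0).2
  · rw [ZFSet.mem_sep]
    constructor
    · rintro ⟨-, k, -, a, ha, rfl⟩
      obtain ⟨j, hj⟩ := (hbt _).1 ha
      rw [hp j] at hj
      exact ⟨j, (ZFSet.pair_inj.1 hj).2⟩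
    · rintro ⟨k, rfl⟩
      exact ⟨(hp' k).1, nat k, nat_mem_omega k, t k, (hbt _).2 ⟨k, rfl⟩, hp k⟩

variable (hM : IsTransitiveModel M) (hZ : IsSpace M Z ζ) (hH : IsHausdorff Z ζ)
  (hc : IsCompactSpace M Z ζ)
include hM hZ hH hc

/-- A filter which is completely prime over `M` and contains the open sets `g(n)` depends only on
the traces of open sets on `⋂ₙ g(n)`. -/
theorem IsPrimeFilter.mem_of_trace_subset (hg : g ∈ M) (hgf : ZFSet.IsFunc ZFSet.omega.{u} ζ g)
    {G Q W : ZFSet.{u}} (hG : IsPrimeFilter M Z ζ G) (hgG : ∀ k, app g (nat k) ∈ G) (hQ : Q ∈ G)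
    (hW : W ∈ ζ) (hQW : ∀ z ∈ Q, (∀ k, z ∈ app g (nat k)) → z ∈ W) : W ∈ G := by
  by_contra hWG
  have hζ := hZ.topology_mem
  have hWM := hM.mem_of_mem hW hζ
  -- If `W ∉ G`, the sets of `G` give a shrinking sequence from `Q` with no term inside `W`, at
  -- first only in `V`. A sequence with range in `M` replaces it, to which compactness in `M`
  -- applies.
  have hstep : ∀ k, ∀ P ∈ G, ∃ P' ∈ G, WellInside Z ζ P' P ∧ WellInside Z ζ P' (app g (nat k)) := by
    intro k P hP
    obtain ⟨P', hP', h⟩ := hG.exists_wellInside hM hZ hH hc (hG.inter_mem _ hP _ (hgG k))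
    exact ⟨P', hP', h.mono (fun _ h => h) fun z hz => (ZFSet.mem_inter.1 hz).1,
      h.mono (fun _ h => h) fun z hz => (ZFSet.mem_inter.1 hz).2⟩
  choose! F hF using hstep
  let s : ℕ → ZFSet.{u} := fun k => Nat.rec Q (fun k P => F k P) k
  have hsG : ∀ k, s k ∈ G := by
    intro k
    induction k with
    | zero => exact hQ
    | succ k ih => exact (hF k _ ih).1
  obtain ⟨t, ht, ht0, b, hb, hbt⟩ := hM.exists_isShrinking (I := ZFSet.sep (fun P => P ⊆ W) ζ)
    (s := s) hZ.carrier_mem hζ hg hgf (hM.sep_mem hζ (hM.subset (.var _) (.const hWM)))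
    ⟨fun k => hG.subset (hsG k),
      fun k h => hWG (hG.mem_of_subset _ (hsG k) W hW (ZFSet.mem_sep.1 h).2),
      fun k => (hF k _ (hsG k)).2.1, fun k => (hF k _ (hsG k)).2.2⟩
  -- Compactness yields a point of all the closures of the `t k` lying outside `W`. It belongs to
  -- `Q` and to every `g(k)`, which contradicts `hQW`.
  obtain ⟨z, hz, hzC⟩ : ∃ z ∈ Z, ∀ O ∈ ZFSet.sep (fun V => V = W ∨ ∃ P ∈ b, ∀ z ∈ P, ¬ z ∈ V) ζ,
      ¬ z ∈ O := by
    by_contra! hcov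
    obtain ⟨D, hD, hDC, hDcov⟩ := exists_finite_subcover hc hZ
      (hM.sep_mem hζ (.or (.eq (.var _) (.const hWM)) (hM.bex (.const hb)
        (hM.ball (.var _) (.not (.mem (.var _) (.var _))))))) ZFSet.sep_subset hcov
    have key : ∃ k, ∀ V ∈ D, V = W ∨ ∀ z ∈ t k, ¬ z ∈ V := by
      clear hDcov
      induction D, hD using Set.Finite.induction_on with
      | empty => exact ⟨0, by simp⟩
      | @insert V D _ _ ih =>
        obtain ⟨k, hk⟩ := ih fun V hV => hDC V (Set.mem_insert_of_mem _ hV)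
        obtain ⟨hV, rfl | ⟨P, hP, hPV⟩⟩ := ZFSet.mem_sep.1 (hDC V (Set.mem_insert _ _))
        · refine ⟨k, fun V' hV' => ?_⟩
          rcases hV' with rfl | hV'
          · exact .inl rfl
          · exact hk V' hV'
        · obtain ⟨j, rfl⟩ := (hbt P).1 hP
          refine ⟨max k j, fun V' hV' => ?_⟩
          rcases hV' with rfl | hV'
          · exact .inr fun z hz => hPV z (ht.antitone hZ.subset (le_max_right k j) hz)
          · exact (hk V' hV').imp_right fun h z hz =>
              h z (ht.antitone hZ.subset (le_max_left k j) hz)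
    obtain ⟨k, hk⟩ := key
    refine ht.notMem k (ZFSet.mem_sep.2 ⟨ht.mem k, fun z hz => ?_⟩)
    obtain ⟨V, hV, hzV⟩ := hDcov z (hZ.subset _ (ht.mem k) hz)
    rcases hk V hV with rfl | h
    · exact hzV
    · exact absurd hzV (h z hz)
  have hin : ∀ k O, WellInside Z ζ (t k) O → z ∈ O := by
    rintro k O ⟨V, hV, h1, h2⟩
    refine (h2 z hz).resolve_right fun hzV => hzC V (ZFSet.mem_sep.2 ⟨hV, .inr ⟨t k, ?_, h1⟩⟩) hzV
    exact (hbt _).2 ⟨k, rfl⟩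
  refine hzC W (ZFSet.mem_sep.2 ⟨hW, .inl rfl⟩) (hQW z ?_ fun k => hin _ _ (ht.wellInside_app k))
  have := hin _ _ (ht.wellInside 0)
  rwa [ht0] at this

/-- A shrinking sequence in a larger model `N` avoiding an ideal `I` extends to a completely prime
filter in `N` avoiding `I`. -/
theorem exists_isPrimeFilter (hN : IsTransitiveModel N) (hMN : M ⊆ N) {t : ℕ → ZFSet.{u}}
    (ht : IsShrinking Z ζ g I t) {b : ZFSet.{u}} (hb : b ∈ N) (hbt : ∀ x, x ∈ b ↔ ∃ k, x = t k)
    (hI : I ∈ N) (hI0 : ∅ ∈ I) (hId : ∀ O ∈ I, ∀ P ∈ ζ, P ⊆ O → P ∈ I)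
    (hIu : ∀ O ∈ I, ∀ P ∈ I, O ∪ P ∈ I) :
    ∃ G ∈ N, IsPrimeFilter M Z ζ G ∧ (∀ O ∈ G, ¬ O ∈ I) ∧
      ∀ O ∈ ζ, ∀ k, WellInside Z ζ (t k) O → O ∈ G := by
  have hζ := hMN hZ.topology_mem
  obtain ⟨p, hp, hp'⟩ := hN.exists_powerset hζ
  -- Filters containing the sequence and avoiding the ideal. A maximal one is prime for finite
  -- covers, as in the prime ideal theorem.
  let Fil : ZFSet.{u} → Prop := fun G => (∀ O ∈ G, ∀ P ∈ ζ, O ⊆ P → P ∈ G) ∧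
    (∀ O ∈ G, ∀ P ∈ G, ∃ R ∈ G, R ⊆ O ∧ R ⊆ P) ∧ b ⊆ G ∧ ∀ O ∈ G, ¬ O ∈ I
  have hFil : Dfn N (fun v : Fin 1 → N => Fil (v 0)) :=
    .and (hN.ball (.var _) (hN.ball (.const hζ) (.imp (hN.subset (.var _) (.var _))
      (.mem (.var _) (.var _))))) (.and (hN.ball (.var _) (hN.ball (.var _) (hN.bex (.var _)
        (.and (hN.subset (.var _) (.var _)) (hN.subset (.var _) (.var _))))))
        (.and (hN.subset (.const hb) (.var _)) (hN.ball (.var _) (.not (.mem (.var _) (.const hI))))))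
  have h𝓕 : ZFSet.sep Fil p ∈ N := hN.sep_mem hp hFil
  have h𝓕' : ∀ G, G ∈ ZFSet.sep Fil p ↔ G ∈ N ∧ G ⊆ ζ ∧ Fil G := fun G => by
    rw [ZFSet.mem_sep, hp', and_assoc]
  obtain ⟨G, hG, hmax⟩ := hN.exists_maximal h𝓕
    (F₀ := ZFSet.sep (fun O => ∃ P ∈ b, P ⊆ O) ζ) (by
      refine (h𝓕' _).2 ⟨hN.sep_mem hζ (hN.bex (.const hb) (hN.subset (.var _) (.var _))),
        ZFSet.sep_subset, ?_, ?_, ?_, ?_⟩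
      · intro O hO P hP hOP
        obtain ⟨-, R, hR, hRO⟩ := ZFSet.mem_sep.1 hO
        exact ZFSet.mem_sep.2 ⟨hP, R, hR, fun z hz => hOP (hRO hz)⟩
      · intro O hO P hP
        obtain ⟨-, R, hR, hRO⟩ := ZFSet.mem_sep.1 hO
        obtain ⟨-, R', hR', hRP⟩ := ZFSet.mem_sep.1 hP
        obtain ⟨i, rfl⟩ := (hbt _).1 hR
        obtain ⟨j, rfl⟩ := (hbt _).1 hR'
        exact ⟨t (max i j), ZFSet.mem_sep.2 ⟨ht.mem _, t (max i j), (hbt _).2 ⟨_, rfl⟩,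
          fun _ h => h⟩, fun z hz => hRO (ht.antitone hZ.subset (le_max_left i j) hz),
          fun z hz => hRP (ht.antitone hZ.subset (le_max_right i j) hz)⟩
      · intro P hP
        obtain ⟨k, rfl⟩ := (hbt _).1 hP
        exact ZFSet.mem_sep.2 ⟨ht.mem k, t k, hP, fun _ h => h⟩
      · intro O hO hOI
        obtain ⟨-, P, hP, hPO⟩ := ZFSet.mem_sep.1 hO
        obtain ⟨k, rfl⟩ := (hbt _).1 hP
        exact ht.notMem k (hId O hOI _ (ht.mem k) hPO))
    (by
      intro K hK hKF hKc ⟨x, hx⟩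
      have hKF' := fun G hG => ((h𝓕' G).1 (hKF hG))
      refine (h𝓕' _).2 ⟨hN.sUnion_mem hK, ?_, ?_, ?_, ?_, ?_⟩
      · intro O hO
        obtain ⟨G, hG, hO⟩ := ZFSet.mem_sUnion.1 hO
        exact (hKF' G hG).2.1 hO
      · intro O hO P hP hOP
        obtain ⟨G, hG, hO⟩ := ZFSet.mem_sUnion.1 hO
        exact ZFSet.mem_sUnion_of_mem ((hKF' G hG).2.2.1 O hO P hP hOP) hG
      · intro O hO P hP
        obtain ⟨G, hG, hO⟩ := ZFSet.mem_sUnion.1 hO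
        obtain ⟨G', hG', hP⟩ := ZFSet.mem_sUnion.1 hP
        rcases hKc G hG G' hG' with h | h
        · obtain ⟨R, hR, hR'⟩ := (hKF' G' hG').2.2.2.1 O (h hO) P hP
          exact ⟨R, ZFSet.mem_sUnion_of_mem hR hG', hR'⟩
        · obtain ⟨R, hR, hR'⟩ := (hKF' G hG).2.2.2.1 O hO P (h hP)
          exact ⟨R, ZFSet.mem_sUnion_of_mem hR hG, hR'⟩
      · intro P hP
        exact ZFSet.mem_sUnion_of_mem ((hKF' x hx).2.2.2.2.1 hP) hx
      · intro O hO
        obtain ⟨G, hG, hO⟩ := ZFSet.mem_sUnion.1 hO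
        exact (hKF' G hG).2.2.2.2.2 O hO)
  obtain ⟨hGN, hGζ, hup, hint, hbG, hGI⟩ := (h𝓕' G).1 hG
  -- Otherwise the filter generated by `G` and `O` would still avoid `I`, against maximality.
  have hext : ∀ O ∈ ζ, ¬ O ∈ G → ∃ Q ∈ G, Q ∩ O ∈ I := by
    intro O hO hOG
    by_contra! hcon
    have hON := hN.mem_of_mem hO hζ
    have hle : G ⊆ ZFSet.sep (fun W => ∃ Q ∈ G, ∀ z ∈ Q, z ∈ O → z ∈ W) ζ := fun Q hQ =>
      ZFSet.mem_sep.2 ⟨hGζ hQ, Q, hQ, fun z hz _ => hz⟩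
    have e := hmax (ZFSet.sep (fun W => ∃ Q ∈ G, ∀ z ∈ Q, z ∈ O → z ∈ W) ζ) (by
      refine (h𝓕' _).2 ⟨hN.sep_mem hζ (hN.bex (.const hGN) (hN.ball (.var _)
        (.imp (.mem (.var _) (.const hON)) (.mem (.var _) (.var _))))), ZFSet.sep_subset,
        ?_, ?_, ?_, ?_⟩
      · intro W hW P hP hWP
        obtain ⟨-, Q, hQ, h⟩ := ZFSet.mem_sep.1 hW
        exact ZFSet.mem_sep.2 ⟨hP, Q, hQ, fun z hz hzO => hWP (h z hz hzO)⟩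
      · intro W hW P hP
        obtain ⟨hWζ, Q, hQ, h⟩ := ZFSet.mem_sep.1 hW
        obtain ⟨hPζ, Q', hQ', h'⟩ := ZFSet.mem_sep.1 hP
        obtain ⟨R, hR, hRQ, hRQ'⟩ := hint Q hQ Q' hQ'
        exact ⟨W ∩ P, ZFSet.mem_sep.2 ⟨hZ.inter_open _ hWζ _ hPζ, R, hR, fun z hz hzO =>
          ZFSet.mem_inter.2 ⟨h z (hRQ hz) hzO, h' z (hRQ' hz) hzO⟩⟩,
          fun z hz => (ZFSet.mem_inter.1 hz).1, fun z hz => (ZFSet.mem_inter.1 hz).2⟩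
      · exact fun P hP => hle (hbG hP)
      · intro W hW hWI
        obtain ⟨-, Q, hQ, h⟩ := ZFSet.mem_sep.1 hW
        exact hcon Q hQ (hId W hWI _ (hZ.inter_open _ (hGζ hQ) _ hO) fun z hz =>
          h z (ZFSet.mem_inter.1 hz).1 (ZFSet.mem_inter.1 hz).2)) hle
    obtain ⟨Q, hQ⟩ : ∃ Q, Q ∈ G := ⟨t 0, hbG ((hbt _).2 ⟨0, rfl⟩)⟩
    exact hOG (e ▸ ZFSet.mem_sep.2 ⟨hO, Q, hQ, fun z _ hz => hz⟩)
  have hfin : ∀ D : Set ZFSet.{u}, D.Finite → (∀ W ∈ D, W ∈ ζ) → (∀ W ∈ D, ¬ W ∈ G) →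
      ∃ Q ∈ G, ∃ J ∈ I, ∀ W ∈ D, ∀ z ∈ Q, z ∈ W → z ∈ J := by
    intro D hD
    induction D, hD using Set.Finite.induction_on with
    | empty => exact fun _ _ => ⟨t 0, hbG ((hbt _).2 ⟨0, rfl⟩), ∅, hI0, by simp⟩
    | @insert V D _ _ ih =>
      intro hDζ hDG
      obtain ⟨Q, hQ, J, hJ, h⟩ := ih (fun W hW => hDζ W (Set.mem_insert_of_mem _ hW))
        (fun W hW => hDG W (Set.mem_insert_of_mem _ hW))
      obtain ⟨Q', hQ', hQV⟩ := hext V (hDζ V (Set.mem_insert _ _)) (hDG V (Set.mem_insert _ _))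
      obtain ⟨R, hR, hRQ, hRQ'⟩ := hint Q hQ Q' hQ'
      refine ⟨R, hR, J ∪ (Q' ∩ V), hIu _ hJ _ hQV, fun W hW z hz hzW => ?_⟩
      rw [ZFSet.mem_union, ZFSet.mem_inter]
      rcases hW with rfl | hW
      · exact .inr ⟨hRQ' hz, hzW⟩
      · exact .inl (h W hW z (hRQ hz) hzW)
  have hprime : ∀ D : Set ZFSet.{u}, D.Finite → (∀ W ∈ D, W ∈ ζ) → ∀ P ∈ G,
      (∀ z ∈ P, ∃ W ∈ D, z ∈ W) → ∃ W ∈ D, W ∈ G := by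
    intro D hD hDζ P hP hPD
    by_contra! hcon
    obtain ⟨Q, hQ, J, hJ, h⟩ := hfin D hD hDζ hcon
    obtain ⟨R, hR, hRP, hRQ⟩ := hint P hP Q hQ
    refine hGI R hR (hId J hJ R (hGζ hR) fun z hz => ?_)
    obtain ⟨W, hW, hzW⟩ := hPD z (hRP hz)
    exact h W hW z (hRQ hz) hzW
  have hwd : Dfn N (fun v : Fin 1 → N => ∃ P ∈ G, WellInside Z ζ P (v 0)) :=
    hN.bex (.const hGN) (hN.wellInside_dfn (hMN hZ.carrier_mem) hζ (.var _) (.var _))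
  have hmemG : ∀ O ∈ ζ, ∀ k, WellInside Z ζ (t k) O →
      O ∈ ZFSet.sep (fun O => ∃ P ∈ G, WellInside Z ζ P O) ζ := fun O hO k h =>
    ZFSet.mem_sep.2 ⟨hO, t k, hbG ((hbt _).2 ⟨k, rfl⟩), h⟩
  -- The maximal filter is prime only for finite covers, so it is rounded: a set is kept if some
  -- member of `G` has closure inside it. Compactness then reduces covers in `M` to finite ones.
  refine ⟨ZFSet.sep (fun O => ∃ P ∈ G, WellInside Z ζ P O) ζ, hN.sep_mem hζ hwd,
    ⟨ZFSet.sep_subset, ?_, ?_, ?_, ?_⟩, ?_, hmemG⟩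
  · exact hmemG Z hZ.univ_open 0 ⟨∅, hZ.empty_open, by simp, fun z hz => .inl hz⟩
  · intro O hO P hP
    obtain ⟨hO, Q, hQ, h⟩ := ZFSet.mem_sep.1 hO
    obtain ⟨hP, Q', hQ', h'⟩ := ZFSet.mem_sep.1 hP
    obtain ⟨R, hR, hRQ, hRQ'⟩ := hint Q hQ Q' hQ'
    refine ZFSet.mem_sep.2 ⟨hZ.inter_open _ hO _ hP, R, hR, (h.inter hM hZ h').mono ?_ fun _ h => h⟩
    exact fun z hz => ZFSet.mem_inter.2 ⟨hRQ hz, hRQ' hz⟩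
  · intro O hO P hP hOP
    obtain ⟨hO, Q, hQ, h⟩ := ZFSet.mem_sep.1 hO
    exact ZFSet.mem_sep.2 ⟨hP, Q, hQ, h.mono (fun _ h => h) hOP⟩
  · intro C hC hCζ hCG
    obtain ⟨-, P, hP, h⟩ := ZFSet.mem_sep.1 hCG
    have hζM := hZ.topology_mem
    -- The cover is refined to sets well inside members of `C`, so that the one chosen by `G` puts a
    -- member of `C` into the rounded filter.
    obtain ⟨D, hD, hDC, hDcov⟩ := exists_finite_cover_of_wellInside hM hZ hc h
      (hZ.subset P (hGζ hP)) (C := ZFSet.sep (fun W => ∃ O ∈ C, WellInside Z ζ W O) ζ)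
      (hM.sep_mem hζM (hM.bex (.const hC) (hM.wellInside_dfn hZ.carrier_mem hζM (.var _) (.var _))))
      ZFSet.sep_subset (fun z hz => by
        obtain ⟨O, hO, hzO⟩ := ZFSet.mem_sUnion.1 hz
        obtain ⟨W, hW, hzW, h⟩ := exists_mem_wellInside hM hZ hH hc (hCζ hO) hzO
        exact ⟨W, ZFSet.mem_sep.2 ⟨hW, O, hO, h⟩, hzW⟩)
    obtain ⟨W, hW, hWG⟩ := hprime D hD (fun W hW => (ZFSet.mem_sep.1 (hDC W hW)).1) P hP hDcov
    obtain ⟨-, O, hO, h⟩ := ZFSet.mem_sep.1 (hDC W hW)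
    exact ⟨O, hO, ZFSet.mem_sep.2 ⟨hCζ hO, W, hWG, h⟩⟩
  · intro O hO hOI
    obtain ⟨-, P, hP, h⟩ := ZFSet.mem_sep.1 hO
    exact hGI P hP (hId O hOI P (hGζ hP) (h.subset (hZ.subset P (hGζ hP))))

end Shrinking

end TopInterp

namespace TopInterp

variable {M N : Set ZFSet.{u}}

/-! ### Filters on interpretable spaces -/

/-- Finiteness is expressed in `N` by a partial surjection from a natural number. A finite subset of
`C ∈ N` is automatically in `N`, so the quantifier over `D` needs no relativization. -/
theorem exists_finite_dfn {n : ℕ} (hN : IsTransitiveModel N) {C : ZFSet.{u}} (hC : C ∈ N)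
    {φ : (Fin n → N) → ZFSet.{u} → Prop}
    (h : Dfn N (fun w : Fin (n + 1) → N => φ (fun i => w i.castSucc) (w (Fin.last n)))) :
    Dfn N (fun v => ∃ D : ZFSet.{u}, {x | x ∈ D}.Finite ∧ D ⊆ C ∧ φ v D) := by
  have key : Dfn N (fun v : Fin n → N => ∃ D ∈ N, (∃ k ∈ ZFSet.omega.{u}, ∃ e ∈ N,
      (∀ d ∈ D, ∃ j ∈ k, ZFSet.pair j d ∈ e) ∧ ∀ j ∈ N, ∀ d ∈ N, ∀ d' ∈ N, ZFSet.pair j d ∈ e →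
        ZFSet.pair j d' ∈ e → d = d') ∧ D ⊆ C ∧ φ v D) :=
    .ex (.and (hN.bex (.const hN.omega_mem) (.ex (.and (hN.ball (.var _) (hN.bex (.var _)
      (hN.pairMem (.var _) (.var _) (.var _)))) (.all (.all (.all (.imp
        (hN.pairMem (.var _) (.var _) (.var _)) (.imp (hN.pairMem (.var _) (.var _) (.var _))
          (.eq (.var _) (.var _)))))))))) (.and (hN.subset (.var _) (.const hC)) h))
  refine key.congr fun v => ⟨?_, ?_⟩
  · rintro ⟨D, hD, hDC, hφ⟩
    have hDN : ∀ x ∈ D, x ∈ N := fun x hx => hN.mem_of_mem (hDC hx) hC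
    obtain ⟨D', hD', e⟩ := hN.exists_of_finite hD hDN
    obtain rfl : D' = D := ZFSet.ext e
    obtain ⟨k, f, -, hf⟩ := Set.Finite.fin_param hD
    have hfD : ∀ i, f i ∈ D' := fun i => (hf ▸ Set.mem_range_self i : f i ∈ {x | x ∈ D'})
    obtain ⟨e, he, he'⟩ := hN.exists_of_finite
      (s := Set.range fun i : Fin k => ZFSet.pair (nat i) (f i)) (Set.finite_range _) (by
        rintro _ ⟨i, rfl⟩
        exact hN.pair_mem (hN.nat_mem _) (hDN _ (hfD i)))
    refine ⟨D', hD', ⟨nat k, nat_mem_omega k, e, he, fun d hd => ?_, ?_⟩, hDC, hφ⟩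
    · obtain ⟨i, rfl⟩ : d ∈ Set.range f := hf ▸ hd
      exact ⟨nat i, mem_nat_iff.2 ⟨i, i.2, rfl⟩, (he' _).2 ⟨i, rfl⟩⟩
    · rintro j - d - d' - h h'
      obtain ⟨i, hi⟩ := (he' _).1 h
      obtain ⟨i', hi'⟩ := (he' _).1 h'
      obtain ⟨rfl, rfl⟩ := ZFSet.pair_inj.1 hi
      obtain ⟨h1, rfl⟩ := ZFSet.pair_inj.1 hi'
      rw [Fin.ext (nat_injective h1)]
  · rintro ⟨D, hD, ⟨k, hk, e, he, h1, h2⟩, hDC, hφ⟩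
    refine ⟨D, ?_, hDC, hφ⟩
    obtain ⟨k, rfl⟩ := mem_omega_iff.1 hk
    choose! f hf hf' using h1
    refine Set.Finite.of_injOn (f := f) (t := {x | x ∈ nat k}) (fun d hd => hf d hd) ?_ ?_
    · intro d hd d' hd' hdd
      have := hf' d hd
      exact h2 (f d) (hN.of_pair_mem this he).1 d (hN.mem_of_mem hd hD) d' (hN.mem_of_mem hd' hD)
        this (hdd ▸ hf' d' hd')
    · refine ((Set.finite_Iio k).image nat).subset fun x hx => ?_
      obtain ⟨j, hj, rfl⟩ := mem_nat_iff.1 hx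
      exact ⟨j, hj, rfl⟩

/-- The image of `Q ∩ Y` under `f : Y → X`. -/
noncomputable def imageSet (X Y f Q : ZFSet.{u}) : ZFSet.{u} :=
  ZFSet.sep (fun x => ∃ y ∈ Y, y ∈ Q ∧ ZFSet.pair y x ∈ f) X

theorem mem_imageSet {X Y f Q x : ZFSet.{u}} :
    x ∈ imageSet X Y f Q ↔ x ∈ X ∧ ∃ y ∈ Y, y ∈ Q ∧ ZFSet.pair y x ∈ f :=
  ZFSet.mem_sep

/-- A filter in `V` on a space interpretable in `M` which is completely prime over `M` and avoids a
family `C ∈ N` can be replaced by such a filter in `N`. -/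
theorem exists_isPrimeFilter_of_isInterpretable (hM : IsTransitiveModel M)
    (hN : IsTransitiveModel N) (hMN : M ⊆ N) {X τ : ZFSet.{u}} (hX : IsInterpretable M X τ)
    {F O C : ZFSet.{u}} (hF : IsPrimeFilter M X τ F) (hO : O ∈ F) (hC : C ∈ N) (hCτ : C ⊆ τ)
    (hFC : ∀ P ∈ C, ¬ P ∈ F) :
    ∃ H ∈ N, IsPrimeFilter M X τ H ∧ O ∈ H ∧ ∀ P ∈ C, ¬ P ∈ H := by
  obtain ⟨hXs, -, -, Y, υ, ⟨hY, Z, ζ, hZ, hH, hc, ⟨g, hg, hgf, hYg⟩, hυ⟩, f, hf, hfs⟩ := hX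
  have hff := hfs.isFunc
  have hζ := hZ.topology_mem
  have hτ := hXs.topology_mem
  have hXM := hXs.carrier_mem
  have hYM := hY.carrier_mem
  have hYZ : ∀ y ∈ Y, y ∈ Z := fun y hy => ((hYg y).1 hy).1
  have hYk : ∀ y ∈ Y, ∀ k, y ∈ app g (nat k) := fun y hy k =>
    ((hYg y).1 hy).2 _ (nat_mem_omega k)
  have hfX : ∀ y x, ZFSet.pair y x ∈ f → y ∈ Y ∧ x ∈ X := fun y x h =>
    ZFSet.pair_mem_prod.1 (hff.1 h)
  have himg : ∀ Q ∈ ζ, imageSet X Y f Q ∈ τ := by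
    intro Q hQ
    convert hfs.isOpen (Q ∩ Y) ((hυ _).2 ⟨Q, hQ, rfl⟩) using 1
    ext x
    rw [mem_imageSet, ZFSet.mem_sep]
    refine and_congr_right fun _ => exists_congr fun y => ?_
    rw [ZFSet.mem_inter]
    constructor
    · rintro ⟨h1, h2, h3⟩
      exact ⟨⟨h2, h1⟩, app_eq hff h3⟩
    · rintro ⟨⟨h2, h1⟩, rfl⟩
      exact ⟨h1, h2, (pair_mem_iff hff h1).2 rfl⟩
  have hpre : ∀ P ∈ τ, ∃ Q ∈ ζ, ∀ y ∈ Y, y ∈ Q ↔ ∃ x ∈ P, ZFSet.pair y x ∈ f := by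
    intro P hP
    obtain ⟨Q, hQ, e⟩ := (hυ _).1 (hfs.continuous P hP)
    refine ⟨Q, hQ, fun y hy => ?_⟩
    have : y ∈ ZFSet.sep (fun y => app f y ∈ P) Y ↔ y ∈ Q ∩ Y := by rw [e]
    rw [ZFSet.mem_sep, ZFSet.mem_inter, and_iff_right hy, and_iff_left hy] at this
    rw [← this]
    constructor
    · intro h
      exact ⟨_, h, (pair_mem_iff hff hy).2 rfl⟩
    · rintro ⟨x, hx, h⟩
      rwa [app_eq hff h]
  -- Points of `Y` lie in every `g(k)`, so the image of `Q` is the union of the images of the open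
  -- sets well inside `Q` and `g(k)`. This family of images is in `M`, and `F` selects one of them.
  have hstep : ∀ k, ∀ Q, Q ∈ ζ ∧ imageSet X Y f Q ∈ F → ∃ Q', (Q' ∈ ζ ∧ imageSet X Y f Q' ∈ F) ∧
      WellInside Z ζ Q' Q ∧ WellInside Z ζ Q' (app g (nat k)) := by
    rintro k Q ⟨hQ, hQF⟩
    have hgk := app_mem hgf (nat_mem_omega k)
    obtain ⟨P, hP, hPF⟩ := hF.prime (ZFSet.sep (fun P => ∃ Q' ∈ ζ,
        (WellInside Z ζ Q' Q ∧ WellInside Z ζ Q' (app g (nat k))) ∧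
        ∀ x ∈ X, x ∈ P ↔ ∃ y ∈ Y, y ∈ Q' ∧ ZFSet.pair y x ∈ f) τ)
      (hM.sep_mem hτ (hM.bex (.const hζ) (.and
        (.and (hM.wellInside_dfn hZ.carrier_mem hζ (.var _) (.const (hM.mem_of_mem hQ hζ)))
          (hM.wellInside_dfn hZ.carrier_mem hζ (.var _) (.const (hM.mem_of_mem hgk hζ))))
        (hM.ball (.const hXM) (.iff (.mem (.var _) (.var _)) (hM.bex (.const hYM)
          (.and (.mem (.var _) (.var _)) (hM.pairMem (.var _) (.var _) (.const hf)))))))))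
      ZFSet.sep_subset (by
        convert hQF using 1
        ext x
        rw [ZFSet.mem_sUnion, mem_imageSet]
        constructor
        · rintro ⟨P, hP, hx⟩
          obtain ⟨hPτ, Q', hQ', ⟨h1, h2⟩, h3⟩ := ZFSet.mem_sep.1 hP
          have hxX := hXs.subset P hPτ hx
          obtain ⟨y, hy, hyQ, hyx⟩ := (h3 x hxX).1 hx
          exact ⟨hxX, y, hy, h1.subset (hZ.subset Q' hQ') hyQ, hyx⟩
        · rintro ⟨hx, y, hy, hyQ, hyx⟩
          obtain ⟨Q', hQ', hyQ', h⟩ := exists_mem_wellInside hM hZ hH hc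
            (hZ.inter_open _ hQ _ hgk) (ZFSet.mem_inter.2 ⟨hyQ, hYk y hy k⟩)
          refine ⟨imageSet X Y f Q', ZFSet.mem_sep.2 ⟨himg Q' hQ', Q', hQ',
            ⟨h.mono (fun _ h => h) fun z hz => (ZFSet.mem_inter.1 hz).1,
            h.mono (fun _ h => h) fun z hz => (ZFSet.mem_inter.1 hz).2⟩, fun x hx => ?_⟩,
            mem_imageSet.2 ⟨hx, y, hy, hyQ', hyx⟩⟩
          rw [mem_imageSet, and_iff_right hx])
    obtain ⟨hPτ, Q', hQ', h, h3⟩ := ZFSet.mem_sep.1 hP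
    refine ⟨Q', ⟨hQ', ?_⟩, h⟩
    convert hPF
    ext x
    rw [mem_imageSet]
    constructor
    · rintro ⟨hx, h⟩
      exact (h3 x hx).2 h
    · intro hx
      have hxX := hXs.subset P hPτ hx
      exact ⟨hxX, (h3 x hxX).1 hx⟩
  obtain ⟨Q₀, hQ₀, hQ₀'⟩ := hpre O (hF.subset hO)
  have himg₀ : imageSet X Y f Q₀ = O := by
    ext x
    rw [mem_imageSet]
    constructor
    · rintro ⟨hx, y, hy, hyQ, hyx⟩
      obtain ⟨x', hx', h⟩ := (hQ₀' y hy).1 hyQ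
      rwa [← app_eq hff hyx, app_eq hff h]
    · intro hx
      have hxX := hXs.subset O (hF.subset hO) hx
      obtain ⟨y, hy, rfl⟩ := hfs.surjective x hxX
      have := (pair_mem_iff hff hy).2 rfl
      exact ⟨hxX, y, hy, (hQ₀' y hy).2 ⟨_, hx, this⟩, this⟩
  choose! E hE hE' using hstep
  let s : ℕ → ZFSet.{u} := fun k => Nat.rec Q₀ (fun k P => E k P) k
  have hs : ∀ k, s k ∈ ζ ∧ imageSet X Y f (s k) ∈ F := by
    intro k
    induction k with
    | zero => exact ⟨hQ₀, himg₀ ▸ hO⟩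
    | succ k ih => exact hE k _ ih
  have hCM : ∀ P ∈ C, P ∈ M := fun P hP => hM.mem_of_mem (hCτ hP) hτ
  -- The ideal of open sets whose trace on `Y` is covered by preimages of finitely many members of
  -- `C`. Primeness of `F` for finite families keeps the sequence out of it.
  set I := ZFSet.sep (fun Q => ∃ D : ZFSet.{u}, {x | x ∈ D}.Finite ∧ D ⊆ C ∧
    ∀ y ∈ Y, y ∈ Q → ∃ P ∈ D, ∃ x ∈ P, ZFSet.pair y x ∈ f) ζ with hIdef
  have hI : I ∈ N := hN.sep_mem (hMN hζ) (exists_finite_dfn hN hC (hN.ball (.const (hMN hYM))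
    (.imp (.mem (.var _) (.var _)) (hN.bex (.var _) (hN.bex (.var _)
      (hN.pairMem (.var _) (.var _) (.const (hMN hf))))))))
  have hFI : ∀ Q, imageSet X Y f Q ∈ F → ¬ Q ∈ I := by
    intro Q hQF hQ
    obtain ⟨-, D, hD, hDC, h⟩ := ZFSet.mem_sep.1 hQ
    obtain ⟨D', hD', e⟩ := hM.exists_of_finite hD fun x hx => hCM x (hDC hx)
    obtain rfl : D' = D := ZFSet.ext e
    have hDτ : D' ⊆ τ := fun P hP => hCτ (hDC hP)
    obtain ⟨P, hP, hPF⟩ := hF.prime D' hD' hDτ (hF.mem_of_subset _ hQF _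
      (hXs.union_open D' hD' hDτ) fun x hx => by
        obtain ⟨-, y, hy, hyQ, hyx⟩ := mem_imageSet.1 hx
        obtain ⟨P, hP, x', hx', h'⟩ := h y hy hyQ
        refine ZFSet.mem_sUnion_of_mem ?_ hP
        rwa [← app_eq hff hyx, app_eq hff h'])
    exact hFC P (hDC hP) hPF
  obtain ⟨t, ht, ht0, b, hb, hbt⟩ := hN.exists_isShrinking (s := s) (hMN hZ.carrier_mem) (hMN hζ)
    (hMN hg) hgf hI ⟨fun k => (hs k).1, fun k => hFI _ (hs k).2,
      fun k => (hE' k _ (hs k)).1, fun k => (hE' k _ (hs k)).2⟩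
  obtain ⟨G, hGN, hG, hGI, hGt⟩ := exists_isPrimeFilter hM hZ hH hc hN hMN ht hb hbt hI
    (ZFSet.mem_sep.2 ⟨hZ.empty_open, ∅, by simp, by simp, by simp⟩)
    (fun O hO P hP hPO => by
      obtain ⟨-, D, hD, hDC, h⟩ := ZFSet.mem_sep.1 hO
      exact ZFSet.mem_sep.2 ⟨hP, D, hD, hDC, fun y hy hyP => h y hy (hPO hyP)⟩)
    (fun O hO P hP => by
      obtain ⟨hO, D, hD, hDC, h⟩ := ZFSet.mem_sep.1 hO
      obtain ⟨hP, D', hD', hDC', h'⟩ := ZFSet.mem_sep.1 hP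
      refine ZFSet.mem_sep.2 ⟨hZ.union_mem hM hO hP, D ∪ D', (hD.union hD').subset ?_, ?_, ?_⟩
      · intro x hx
        exact ZFSet.mem_union.1 hx
      · intro x hx
        rcases ZFSet.mem_union.1 hx with hx | hx
        · exact hDC hx
        · exact hDC' hx
      · intro y hy hyOP
        rcases ZFSet.mem_union.1 hyOP with hyO | hyP
        · obtain ⟨P, hP, k⟩ := h y hy hyO
          exact ⟨P, ZFSet.mem_union.2 (.inl hP), k⟩
        · obtain ⟨P, hP, k⟩ := h' y hy hyP
          exact ⟨P, ZFSet.mem_union.2 (.inr hP), k⟩)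
  -- The index is `1` because it is `t 1` that is well inside `t 0 = Q₀`.
  have hQ₀G : Q₀ ∈ G := hGt Q₀ hQ₀ 1 (by
    have := ht.wellInside 0
    rwa [ht0] at this)
  have hgG : ∀ k, app g (nat k) ∈ G := fun k =>
    hGt _ (app_mem hgf (nat_mem_omega k)) (k + 1) (ht.wellInside_app k)
  -- The pushforward of `G` along `f`.
  have hHdfn : ZFSet.sep (fun P => ∃ Q ∈ G, ∀ y ∈ Y, y ∈ Q → ∃ x ∈ P, ZFSet.pair y x ∈ f) τ ∈ N :=
    hN.sep_mem (hMN hτ) (hN.bex (.const hGN) (hN.ball (.const (hMN hYM))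
      (.imp (.mem (.var _) (.var _)) (hN.bex (.var _)
        (hN.pairMem (.var _) (.var _) (.const (hMN hf)))))))
  refine ⟨_, hHdfn, ⟨ZFSet.sep_subset, ?_, ?_, ?_, ?_⟩, ?_, ?_⟩
  · refine ZFSet.mem_sep.2 ⟨hXs.univ_open, Z, hG.univ_mem, fun y hy _ => ?_⟩
    exact ⟨app f y, app_mem hff hy, (pair_mem_iff hff hy).2 rfl⟩
  · intro P hP P' hP'
    obtain ⟨hP, Q, hQ, h⟩ := ZFSet.mem_sep.1 hP
    obtain ⟨hP', Q', hQ', h'⟩ := ZFSet.mem_sep.1 hP'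
    refine ZFSet.mem_sep.2 ⟨hXs.inter_open _ hP _ hP', Q ∩ Q', hG.inter_mem _ hQ _ hQ',
      fun y hy hyQ => ?_⟩
    rw [ZFSet.mem_inter] at hyQ
    obtain ⟨x, hx, hyx⟩ := h y hy hyQ.1
    obtain ⟨x', hx', hyx'⟩ := h' y hy hyQ.2
    obtain rfl : x = x' := (app_eq hff hyx).symm.trans (app_eq hff hyx')
    exact ⟨x, ZFSet.mem_inter.2 ⟨hx, hx'⟩, hyx⟩
  · intro P hP P' hP' hPP'
    obtain ⟨hP, Q, hQ, h⟩ := ZFSet.mem_sep.1 hP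
    refine ZFSet.mem_sep.2 ⟨hP', Q, hQ, fun y hy hyQ => ?_⟩
    obtain ⟨x, hx, hyx⟩ := h y hy hyQ
    exact ⟨x, hPP' hx, hyx⟩
  · intro K hK hKτ hKH
    obtain ⟨-, Q, hQ, h⟩ := ZFSet.mem_sep.1 hKH
    let 𝓦 := ZFSet.sep (fun W => ∃ P ∈ K, ∀ y ∈ Y, y ∈ W → ∃ x ∈ P, ZFSet.pair y x ∈ f) ζ
    have h𝓦 : 𝓦 ∈ M := hM.sep_mem hζ (hM.bex (.const hK) (hM.ball (.const hYM)
      (.imp (.mem (.var _) (.var _)) (hM.bex (.var _)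
        (hM.pairMem (.var _) (.var _) (.const hf))))))
    have h𝓦ζ : 𝓦 ⊆ ζ := ZFSet.sep_subset
    -- `Q` lies in the union of `𝓦` only after intersection with `Y`; dependence of `G` on traces
    -- alone puts that union into `G`.
    have hW := hG.mem_of_trace_subset hM hZ hH hc hg hgf hgG hQ (hZ.union_open 𝓦 h𝓦 h𝓦ζ) (by
      intro z hz hzk
      have hzY : z ∈ Y := (hYg z).2 ⟨hZ.subset Q (hG.subset hQ) hz, fun n hn => by
        obtain ⟨k, rfl⟩ := mem_omega_iff.1 hn
        exact hzk k⟩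
      obtain ⟨x, hx, hzx⟩ := h z hzY hz
      obtain ⟨P, hP, hxP⟩ := ZFSet.mem_sUnion.1 hx
      obtain ⟨W, hW, hW'⟩ := hpre P (hKτ hP)
      exact ZFSet.mem_sUnion_of_mem ((hW' z hzY).2 ⟨x, hxP, hzx⟩)
        (ZFSet.mem_sep.2 ⟨hW, P, hP, fun y hy hyW => (hW' y hy).1 hyW⟩))
    obtain ⟨W, hW, hWG⟩ := hG.prime 𝓦 h𝓦 h𝓦ζ hW
    obtain ⟨-, P, hP, h'⟩ := ZFSet.mem_sep.1 hW
    exact ⟨P, hP, ZFSet.mem_sep.2 ⟨hKτ hP, W, hWG, h'⟩⟩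
  · exact ZFSet.mem_sep.2 ⟨hF.subset hO, Q₀, hQ₀G, fun y hy hyQ => (hQ₀' y hy).1 hyQ⟩
  · intro P hP hPH
    obtain ⟨-, Q, hQ, h⟩ := ZFSet.mem_sep.1 hPH
    refine hGI Q hQ (ZFSet.mem_sep.2 ⟨hG.subset hQ, {P}, ?_, ?_, fun y hy hyQ =>
      ⟨P, ZFSet.mem_singleton.2 rfl, h y hy hyQ⟩⟩)
    · simp
    · intro x hx
      rwa [ZFSet.mem_singleton.1 hx]

end TopInterp

namespace TopInterp

variable {M N : Set ZFSet.{u}} {X τ Y σ p q : ZFSet.{u}}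

/-! ### Points of interpretations -/

theorem IsPreinterpretation.mono (h : IsPreinterpretation N M X τ Y σ p q) {O P : ZFSet.{u}}
    (hO : O ∈ τ) (hP : P ∈ τ) (hOP : O ⊆ P) : app q O ⊆ app q P := by
  intro y hy
  have := h.map_inter O hO P hP
  rw [ZFSet.inter_eq_left_of_subset hOP] at this
  rw [this] at hy
  exact (ZFSet.mem_inter.1 hy).2

/-- The open sets whose interpretation contains a given point form a completely prime filter. -/
theorem IsPreinterpretation.isPrimeFilter (h : IsPreinterpretation N M X τ Y σ p q) {y : ZFSet.{u}}
    (hy : y ∈ Y) : IsPrimeFilter M X τ (ZFSet.sep (fun O => y ∈ app q O) τ) where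
  subset := ZFSet.sep_subset
  univ_mem := ZFSet.mem_sep.2 ⟨h.source.univ_open, by rwa [h.map_univ]⟩
  inter_mem O hO P hP := by
    rw [ZFSet.mem_sep] at hO hP ⊢
    rw [h.map_inter O hO.1 P hP.1]
    exact ⟨h.source.inter_open _ hO.1 _ hP.1, ZFSet.mem_inter.2 ⟨hO.2, hP.2⟩⟩
  mem_of_subset O hO P hP hOP := by
    rw [ZFSet.mem_sep] at hO ⊢
    exact ⟨hP, h.mono hO.1 hP hOP hO.2⟩
  prime C hC hCτ hCF := by
    obtain ⟨O, hO, hy⟩ := (h.map_union C hC hCτ y).1 (ZFSet.mem_sep.1 hCF).2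
    exact ⟨O, hO, ZFSet.mem_sep.2 ⟨hCτ hO, hy⟩⟩

theorem isPrimeFilter_of_mem (hX : IsSpace M X τ) {x : ZFSet.{u}} (hx : x ∈ X) :
    IsPrimeFilter M X τ (ZFSet.sep (fun O => x ∈ O) τ) where
  subset := ZFSet.sep_subset
  univ_mem := ZFSet.mem_sep.2 ⟨hX.univ_open, hx⟩
  inter_mem O hO P hP := by
    rw [ZFSet.mem_sep] at hO hP ⊢
    exact ⟨hX.inter_open _ hO.1 _ hP.1, ZFSet.mem_inter.2 ⟨hO.2, hP.2⟩⟩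
  mem_of_subset O hO P hP hOP := by
    rw [ZFSet.mem_sep] at hO ⊢
    exact ⟨hP, hOP hO.2⟩
  prime C hC hCτ hCF := by
    obtain ⟨O, hO, hy⟩ := ZFSet.mem_sUnion.1 (ZFSet.mem_sep.1 hCF).2
    exact ⟨O, hO, ZFSet.mem_sep.2 ⟨hCτ hO, hy⟩⟩

theorem exists_isFunc (hN : IsTransitiveModel N) {A B : ZFSet.{u}} (hA : A ∈ N) (hB : B ∈ N)
    (t : ZFSet.{u} → ZFSet.{u}) (ht : ∀ x ∈ A, t x ∈ B) {ρ : ZFSet.{u} → ZFSet.{u} → Prop}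
    (h : Dfn N (fun v : Fin 2 → N => ρ (v 0) (v 1)))
    (hρ : ∀ x ∈ A, ∀ y ∈ N, ρ x y ↔ y = t x) :
    ∃ f ∈ N, ZFSet.IsFunc A B f ∧ ∀ x ∈ A, app f x = t x := by
  have htN : ∀ x ∈ A, t x ∈ N := fun x hx => hN.mem_of_mem (ht x hx) hB
  obtain ⟨f, hf, hf'⟩ := hN.exists_graph hA h fun x hx =>
    ⟨t x, ⟨htN x hx, (hρ x hx _ (htN x hx)).2 rfl⟩, fun y hy => (hρ x hx y hy.1).1 hy.2⟩
  have hmem : ∀ x ∈ A, ∀ y, ZFSet.pair x y ∈ f ↔ y = t x := by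
    intro x hx y
    rw [hf']
    constructor
    · rintro ⟨x', hx', y', hy', h, e⟩
      obtain ⟨rfl, rfl⟩ := ZFSet.pair_inj.1 e
      exact (hρ x hx y hy').1 h
    · rintro rfl
      exact ⟨x, hx, t x, htN x hx, (hρ x hx _ (htN x hx)).2 rfl, rfl⟩
  have hfun : ZFSet.IsFunc A B f := by
    refine ⟨fun w hw => ?_, fun x hx => ⟨t x, (hmem x hx _).2 rfl, fun y hy => (hmem x hx y).1 hy⟩⟩
    obtain ⟨x, hx, y, hy, h, rfl⟩ := (hf' w).1 hw
    exact ZFSet.pair_mem_prod.2 ⟨hx, by rw [(hρ x hx y hy).1 h]; exact ht x hx⟩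
  exact ⟨f, hf, hfun, fun x hx => app_eq hfun ((hmem x hx _).2 rfl)⟩

/-- The class `M` need not be definable over `N`, but the power set of `τ` in the sense of `M` is an
element of `N` and bounds the quantifier over families in `M`. -/
theorem IsTransitiveModel.isPrimeFilter_dfn (hM : IsTransitiveModel M) (hN : IsTransitiveModel N)
    (hMN : M ⊆ N) (hX : IsSpace M X τ) :
    Dfn N (fun v : Fin 1 → N => IsPrimeFilter M X τ (v 0)) := by
  obtain ⟨P, hP, hP'⟩ := hM.exists_powerset hX.topology_mem
  have hτ := hMN hX.topology_mem
  have hd : Dfn N (fun v : Fin 1 → N => (v 0 : ZFSet.{u}) ⊆ τ ∧ X ∈ (v 0 : ZFSet.{u}) ∧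
      (∀ O ∈ (v 0 : ZFSet.{u}), ∀ P ∈ (v 0 : ZFSet.{u}), ∃ R ∈ (v 0 : ZFSet.{u}), R ⊆ O ∧ R ⊆ P) ∧
      (∀ O ∈ (v 0 : ZFSet.{u}), ∀ P ∈ τ, O ⊆ P → P ∈ (v 0 : ZFSet.{u})) ∧
      ∀ C ∈ P, (⋃₀ C : ZFSet.{u}) ∈ (v 0 : ZFSet.{u}) → ∃ O ∈ C, O ∈ (v 0 : ZFSet.{u})) :=
    .and (hN.subset (.var _) (.const hτ)) (.and (.mem (.const (hMN hX.carrier_mem)) (.var _))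
      (.and (hN.ball (.var _) (hN.ball (.var _) (hN.bex (.var _) (.and (hN.subset (.var _) (.var _))
        (hN.subset (.var _) (.var _)))))) (.and (hN.ball (.var _) (hN.ball (.const hτ)
          (.imp (hN.subset (.var _) (.var _)) (.mem (.var _) (.var _)))))
        (hN.ball (.const (hMN hP)) (.imp (hN.sUnion_mem_dfn (.var _) (.var _))
          (hN.bex (.var _) (.mem (.var _) (.var _))))))))
  refine hd.congr fun v => ⟨fun h => ⟨h.subset, h.univ_mem, fun O hO P hP => ?_, h.mem_of_subset,
    fun C hC => h.prime C ((hP' C).1 hC).1 ((hP' C).1 hC).2⟩, ?_⟩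
  · exact ⟨_, h.inter_mem O hO P hP, fun z hz => (ZFSet.mem_inter.1 hz).1,
      fun z hz => (ZFSet.mem_inter.1 hz).2⟩
  · rintro ⟨h1, h2, h3, h4, h5⟩
    refine ⟨h1, h2, fun O hO P hP => ?_, h4, fun C hC hCτ => h5 C ((hP' C).2 ⟨hC, hCτ⟩)⟩
    obtain ⟨R, hR, hRO, hRP⟩ := h3 O hO P hP
    exact h4 R hR _ (hX.inter_open _ (h1 hO) _ (h1 hP)) fun z hz =>
      ZFSet.mem_inter.2 ⟨hRO hz, hRP hz⟩

/-- Every completely prime filter in `N` is realized by a point of an interpretation in `N`. -/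
theorem IsInterpretation.exists_point (hM : IsTransitiveModel M) (hN : IsTransitiveModel N)
    (hMN : M ⊆ N) (hI : IsInterpretation N M X τ Y σ p q) {F : ZFSet.{u}} (hFN : F ∈ N)
    (hF : IsPrimeFilter M X τ F) : ∃ y ∈ Y, ∀ O ∈ τ, y ∈ app q O ↔ O ∈ F := by
  have hX := hI.1.source
  have hXN := hMN hX.carrier_mem
  have hτ := hMN hX.topology_mem
  obtain ⟨P, hP, hP'⟩ := hN.exists_powerset hτ
  -- The space of all completely prime filters in `N`, with basic open sets `{y | O ∈ y}`, is a
  -- preinterpretation. Its reduction to the given interpretation sends `F` to the required point.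
  set Y' := ZFSet.sep (fun F => IsPrimeFilter M X τ F) P with hY'def
  have hY' : Y' ∈ N := hN.sep_mem hP (hM.isPrimeFilter_dfn hN hMN hX)
  have hY'mem : ∀ F, F ∈ Y' ↔ F ∈ N ∧ IsPrimeFilter M X τ F := fun F => by
    rw [hY'def, ZFSet.mem_sep, hP']
    exact ⟨fun h => ⟨h.1.1, h.2⟩, fun h => ⟨⟨h.1, h.2.subset⟩, h.2⟩⟩
  obtain ⟨PY, hPY, hPY'⟩ := hN.exists_powerset hY'
  set σ' := ZFSet.sep (fun U => ∀ y ∈ U, ∃ O ∈ τ, O ∈ y ∧ ∀ y' ∈ Y', O ∈ y' → y' ∈ U) PY with hσ'def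
  have hσ' : σ' ∈ N := hN.sep_mem hPY (hN.ball (.var _) (hN.bex (.const hτ)
    (.and (.mem (.var _) (.var _)) (hN.ball (.const hY') (.imp (.mem (.var _) (.var _))
      (.mem (.var _) (.var _)))))))
  have hσ'mem : ∀ U, U ∈ σ' ↔ (U ∈ N ∧ U ⊆ Y') ∧
      ∀ y ∈ U, ∃ O ∈ τ, O ∈ y ∧ ∀ y' ∈ Y', O ∈ y' → y' ∈ U := fun U => by
    rw [hσ'def, ZFSet.mem_sep, hPY']
  clear_value Y' σ'
  have hQσ : ∀ O ∈ τ, ZFSet.sep (fun y => O ∈ y) Y' ∈ σ' := fun O hO =>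
    (hσ'mem _).2 ⟨⟨hN.sep_mem hY' (.mem (.const (hN.mem_of_mem hO hτ)) (.var _)),
      ZFSet.sep_subset⟩, fun y hy => ⟨O, hO, (ZFSet.mem_sep.1 hy).2, fun y' hy' h =>
        ZFSet.mem_sep.2 ⟨hy', h⟩⟩⟩
  have hPY'' : ∀ x ∈ X, ZFSet.sep (fun O => x ∈ O) τ ∈ Y' := fun x hx =>
    (hY'mem _).2 ⟨hN.sep_mem hτ (.mem (.const (hN.mem_of_mem hx hXN)) (.var _)),
      isPrimeFilter_of_mem hX hx⟩
  obtain ⟨p', hp', hpf, hpa⟩ := exists_isFunc hN hXN hY' (fun x => ZFSet.sep (fun O => x ∈ O) τ) hPY''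
    (ρ := fun x y => ∀ O ∈ N, O ∈ y ↔ O ∈ τ ∧ x ∈ O)
    (.all (.iff (.mem (.var _) (.var _)) (.and (.mem (.var _) (.const hτ)) (.mem (.var _) (.var _)))))
    (fun x hx y hy => by
      constructor
      · intro h
        ext O
        rw [ZFSet.mem_sep]
        exact ⟨fun hO => (h O (hN.mem_of_mem hO hy)).1 hO,
          fun hO => (h O (hN.mem_of_mem hO.1 hτ)).2 hO⟩
      · rintro rfl O -
        exact ZFSet.mem_sep)
  obtain ⟨q', hq', hqf, hqa⟩ := exists_isFunc hN hτ hσ' (fun O => ZFSet.sep (fun y => O ∈ y) Y') hQσ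
    (ρ := fun O U => ∀ y ∈ N, y ∈ U ↔ y ∈ Y' ∧ O ∈ y)
    (.all (.iff (.mem (.var _) (.var _)) (.and (.mem (.var _) (.const hY')) (.mem (.var _) (.var _)))))
    (fun x hx y hy => by
      constructor
      · intro h
        ext O
        rw [ZFSet.mem_sep]
        exact ⟨fun hO => (h O (hN.mem_of_mem hO hy)).1 hO,
          fun hO => (h O (hN.mem_of_mem hO.1 hY')).2 hO⟩
      · rintro rfl O -
        exact ZFSet.mem_sep)
  have hqm : ∀ O ∈ τ, ∀ y, y ∈ app q' O ↔ y ∈ Y' ∧ O ∈ y := fun O hO y => by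
    rw [hqa O hO, ZFSet.mem_sep]
  have hpre : IsPreinterpretation N M X τ Y' σ' p' q' := by
    refine ⟨hX, ⟨hY', hσ', fun U hU => ((hσ'mem U).1 hU).1.2, ?_, ?_, ?_, ?_, ?_⟩, hp', hq', hpf, hqf,
      ?_, ?_, ?_, ?_, ?_, ?_⟩
    · exact (hσ'mem _).2 ⟨⟨hN.empty_mem, by simp⟩, by simp⟩
    · exact (hσ'mem _).2 ⟨⟨hY', fun _ h => h⟩, fun y hy => ⟨X, hX.univ_open,
        ((hY'mem y).1 hy).2.univ_mem, fun y' hy' _ => hy'⟩⟩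
    · intro U hU V hV
      obtain ⟨⟨hUN, hUY⟩, h⟩ := (hσ'mem U).1 hU
      obtain ⟨⟨hVN, hVY⟩, h'⟩ := (hσ'mem V).1 hV
      refine (hσ'mem _).2 ⟨⟨hN.inter_mem hUN hVN, fun y hy => hUY (ZFSet.mem_inter.1 hy).1⟩,
        fun y hy => ?_⟩
      rw [ZFSet.mem_inter] at hy
      obtain ⟨O, hO, hOy, h1⟩ := h y hy.1
      obtain ⟨O', hO', hOy', h1'⟩ := h' y hy.2
      refine ⟨O ∩ O', hX.inter_open _ hO _ hO', ((hY'mem y).1 (hUY hy.1)).2.inter_mem _ hOy _ hOy',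
        fun y' hy' hyO => ?_⟩
      have hf := ((hY'mem y').1 hy').2
      exact ZFSet.mem_inter.2
        ⟨h1 y' hy' (hf.mem_of_subset _ hyO O hO fun z hz => (ZFSet.mem_inter.1 hz).1),
        h1' y' hy' (hf.mem_of_subset _ hyO O' hO' fun z hz => (ZFSet.mem_inter.1 hz).2)⟩
    · intro C hC hCσ
      refine (hσ'mem _).2 ⟨⟨hN.sUnion_mem hC, fun y hy => ?_⟩, fun y hy => ?_⟩
      · obtain ⟨U, hU, hyU⟩ := ZFSet.mem_sUnion.1 hy
        exact ((hσ'mem U).1 (hCσ hU)).1.2 hyU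
      · obtain ⟨U, hU, hyU⟩ := ZFSet.mem_sUnion.1 hy
        obtain ⟨O, hO, hOy, h⟩ := ((hσ'mem U).1 (hCσ hU)).2 y hyU
        exact ⟨O, hO, hOy, fun y' hy' hyO => ZFSet.mem_sUnion_of_mem (h y' hy' hyO) hU⟩
    · intro y hy y' hy' h
      have e : ∀ O ∈ τ, O ∈ y ↔ O ∈ y' := by
        intro O hO
        have := h _ (hQσ O hO)
        rwa [ZFSet.mem_sep, ZFSet.mem_sep, and_iff_right hy, and_iff_right hy'] at this
      ext O
      exact ⟨fun hO => (e O (((hY'mem y).1 hy).2.subset hO)).1 hO,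
        fun hO => (e O (((hY'mem y').1 hy').2.subset hO)).2 hO⟩
    · intro x hx O hO
      rw [hqm O hO, hpa x hx, ZFSet.mem_sep, and_iff_right hO, and_iff_right (hPY'' x hx)]
    · intro O hO V hV
      ext y
      rw [ZFSet.mem_inter, hqm _ (hX.inter_open _ hO _ hV), hqm O hO, hqm V hV]
      constructor
      · rintro ⟨hy, h⟩
        have hf := ((hY'mem y).1 hy).2
        exact ⟨⟨hy, hf.mem_of_subset _ h O hO fun z hz => (ZFSet.mem_inter.1 hz).1⟩,
          hy, hf.mem_of_subset _ h V hV fun z hz => (ZFSet.mem_inter.1 hz).2⟩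
      · rintro ⟨⟨hy, h⟩, -, h'⟩
        exact ⟨hy, ((hY'mem y).1 hy).2.inter_mem _ h _ h'⟩
    · intro C hC hCτ y
      rw [hqm _ (hX.union_open C hC hCτ)]
      constructor
      · rintro ⟨hy, h⟩
        obtain ⟨O, hO, hOy⟩ := ((hY'mem y).1 hy).2.prime C hC hCτ h
        exact ⟨O, hO, (hqm O (hCτ hO) y).2 ⟨hy, hOy⟩⟩
      · rintro ⟨O, hO, hy⟩
        obtain ⟨hy, hOy⟩ := (hqm O (hCτ hO) y).1 hy
        exact ⟨hy, ((hY'mem y).1 hy).2.mem_of_subset O hOy _ (hX.union_open C hC hCτ)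
          fun z hz => ZFSet.mem_sUnion_of_mem hz hO⟩
    · rw [ZFSet.eq_empty]
      intro y hy
      obtain ⟨hy, h⟩ := (hqm _ hX.empty_open y).1 hy
      obtain ⟨O, hO, -⟩ := ((hY'mem y).1 hy).2.prime ∅ hM.empty_mem (by simp) (by simpa using h)
      exact ZFSet.notMem_empty O hO
    · ext y
      rw [hqm _ hX.univ_open, and_iff_left_of_imp]
      exact fun hy => ((hY'mem y).1 hy).2.univ_mem
    · intro U hU y hy
      obtain ⟨O, hO, hOy, h⟩ := ((hσ'mem U).1 hU).2 y hy
      exact ⟨O, hO, (hqm O hO y).2 ⟨((hσ'mem U).1 hU).1.2 hy, hOy⟩,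
        fun y' hy' => h y' ((hqm O hO y').1 hy').1 ((hqm O hO y').1 hy').2⟩
  obtain ⟨h, -, hr⟩ := hI.2 Y' σ' p' q' hpre
  have hFY : F ∈ Y' := (hY'mem F).2 ⟨hFN, hF⟩
  refine ⟨app h F, app_mem hr.isFunc hFY, fun O hO => ?_⟩
  rw [hr.preimage_eq O hO F hFY, hqm O hO, and_iff_right hFY]

/-! ### Composition -/

theorem pair_mem_comp {A B C f g x : ZFSet.{u}} (hf : ZFSet.IsFunc A B f)
    (hg : ZFSet.IsFunc B C g) (hx : x ∈ A) {z : ZFSet.{u}} :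
    ZFSet.pair x z ∈ comp A C g f ↔ z = app g (app f x) := by
  rw [comp, ZFSet.mem_sep, ZFSet.pair_mem_prod]
  constructor
  · rintro ⟨-, x', y, z', e, h1, h2⟩
    obtain ⟨rfl, rfl⟩ := ZFSet.pair_inj.1 e
    rw [app_eq hf h1, app_eq hg h2]
  · rintro rfl
    have h1 := app_mem hf hx
    exact ⟨⟨hx, app_mem hg h1⟩, x, app f x, _, rfl, (pair_mem_iff hf hx).2 rfl,
      (pair_mem_iff hg h1).2 rfl⟩

theorem comp_isFunc {A B C f g : ZFSet.{u}} (hf : ZFSet.IsFunc A B f) (hg : ZFSet.IsFunc B C g) :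
    ZFSet.IsFunc A C (comp A C g f) :=
  ⟨ZFSet.sep_subset, fun _ hx => ⟨_, (pair_mem_comp hf hg hx).2 rfl,
    fun _ h => (pair_mem_comp hf hg hx).1 h⟩⟩

theorem app_comp {A B C f g x : ZFSet.{u}} (hf : ZFSet.IsFunc A B f) (hg : ZFSet.IsFunc B C g)
    (hx : x ∈ A) : app (comp A C g f) x = app g (app f x) :=
  app_eq (comp_isFunc hf hg) ((pair_mem_comp hf hg hx).2 rfl)

/-! ### Composition of interpretations of an interpretable space. -/

variable {M₀ M₁ : Set ZFSet.{u}} {X₀ τ₀ X₁ τ₁ X₂ τ₂ p₀ q₀ p₁ q₁ : ZFSet.{u}}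

theorem isPreinterpretation_comp (hM₁ : IsTransitiveModel M₁)
    (hsub : M₀ ⊆ M₁) (h₀ : IsPreinterpretation M₁ M₀ X₀ τ₀ X₁ τ₁ p₀ q₀)
    (h₁ : IsPreinterpretation N M₁ X₁ τ₁ X₂ τ₂ p₁ q₁)
    (hp : comp X₀ X₂ p₁ p₀ ∈ N) (hq : comp τ₀ τ₂ q₁ q₀ ∈ N) :
    IsPreinterpretation N M₀ X₀ τ₀ X₂ τ₂ (comp X₀ X₂ p₁ p₀) (comp τ₀ τ₂ q₁ q₀) := by
  have ep : ∀ x ∈ X₀, app (comp X₀ X₂ p₁ p₀) x = app p₁ (app p₀ x) := fun x hx =>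
    app_comp h₀.points_isFunc h₁.points_isFunc hx
  have eq : ∀ O ∈ τ₀, app (comp τ₀ τ₂ q₁ q₀) O = app q₁ (app q₀ O) := fun O hO =>
    app_comp h₀.opens_isFunc h₁.opens_isFunc hO
  have hX₀ := h₀.source
  have hq₀ : ∀ O ∈ τ₀, app q₀ O ∈ τ₁ := fun O hO => app_mem h₀.opens_isFunc hO
  have hτ₀ := hsub hX₀.topology_mem
  have hτ₁ := h₀.target.topology_mem
  refine ⟨hX₀, h₁.target, hp, hq, comp_isFunc h₀.points_isFunc h₁.points_isFunc,
    comp_isFunc h₀.opens_isFunc h₁.opens_isFunc, ?_, ?_, ?_, ?_, ?_, ?_⟩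
  · intro x hx O hO
    rw [ep x hx, eq O hO, h₀.mem_iff x hx O hO,
      h₁.mem_iff _ (app_mem h₀.points_isFunc hx) _ (hq₀ O hO)]
  · intro O hO P hP
    rw [eq O hO, eq P hP, eq _ (hX₀.inter_open _ hO _ hP), h₀.map_inter O hO P hP,
      h₁.map_inter _ (hq₀ O hO) _ (hq₀ P hP)]
  · intro C hC hCτ z
    -- The images under `q₀` of the members of `C` form a family in `M₁`, so the union condition of
    -- the second preinterpretation applies to it.
    have hDM : ZFSet.sep (fun U => ∃ O ∈ C, ZFSet.pair O U ∈ q₀) τ₁ ∈ M₁ :=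
      hM₁.sep_mem hτ₁ (hM₁.bex (.const (hsub hC))
        (hM₁.pairMem (.var _) (.var _) (.const h₀.opens_mem)))
    have e : app q₀ (⋃₀ C) = ⋃₀ (ZFSet.sep (fun U => ∃ O ∈ C, ZFSet.pair O U ∈ q₀) τ₁) := by
      ext y
      rw [h₀.map_union C hC hCτ, ZFSet.mem_sUnion]
      constructor
      · rintro ⟨O, hO, hy⟩
        exact ⟨_, ZFSet.mem_sep.2 ⟨hq₀ O (hCτ hO), O, hO,
          (pair_mem_iff h₀.opens_isFunc (hCτ hO)).2 rfl⟩, hy⟩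
      · rintro ⟨U, hU, hy⟩
        obtain ⟨-, O, hO, h⟩ := ZFSet.mem_sep.1 hU
        exact ⟨O, hO, by rwa [app_eq h₀.opens_isFunc h]⟩
    rw [eq _ (hX₀.union_open C hC hCτ), e, h₁.map_union _ hDM ZFSet.sep_subset]
    constructor
    · rintro ⟨U, hU, hz⟩
      obtain ⟨-, O, hO, h⟩ := ZFSet.mem_sep.1 hU
      exact ⟨O, hO, by rwa [eq O (hCτ hO), app_eq h₀.opens_isFunc h]⟩
    · rintro ⟨O, hO, hz⟩
      rw [eq O (hCτ hO)] at hz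
      exact ⟨_, ZFSet.mem_sep.2 ⟨hq₀ O (hCτ hO), O, hO,
          (pair_mem_iff h₀.opens_isFunc (hCτ hO)).2 rfl⟩, hz⟩
  · rw [eq _ hX₀.empty_open, h₀.map_empty, h₁.map_empty]
  · rw [eq _ hX₀.univ_open, h₀.map_univ, h₁.map_univ]
  · intro V hV z hz
    obtain ⟨U, hU, hzU, hUV⟩ := h₁.basis V hV z hz
    have hUM := hM₁.mem_of_mem hU hτ₁
    have hDM : ZFSet.sep (fun W => W ⊆ U ∧ ∃ O ∈ τ₀, ZFSet.pair O W ∈ q₀) τ₁ ∈ M₁ :=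
      hM₁.sep_mem hτ₁ (.and (hM₁.subset (.var _) (.const hUM)) (hM₁.bex (.const hτ₀)
        (hM₁.pairMem (.var _) (.var _) (.const h₀.opens_mem))))
    -- Each open set of `X₁` is the union of a family in `M₁` of interpreted open sets, and `q₁`
    -- preserves this union; hence the composed images form a basis.
    have e : U = ⋃₀ (ZFSet.sep (fun W => W ⊆ U ∧ ∃ O ∈ τ₀, ZFSet.pair O W ∈ q₀) τ₁) := by
      ext y
      rw [ZFSet.mem_sUnion]
      constructor
      · intro hy
        obtain ⟨O, hO, hyO, hOU⟩ := h₀.basis U hU y hy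
        exact ⟨_, ZFSet.mem_sep.2 ⟨hq₀ O hO, hOU, O, hO,
          (pair_mem_iff h₀.opens_isFunc hO).2 rfl⟩, hyO⟩
      · rintro ⟨W, hW, hy⟩
        exact (ZFSet.mem_sep.1 hW).2.1 hy
    have hz' := hzU
    rw [e, h₁.map_union _ hDM ZFSet.sep_subset] at hz'
    obtain ⟨W, hW, hzW⟩ := hz'
    obtain ⟨hWτ, hWU, O, hO, h⟩ := ZFSet.mem_sep.1 hW
    refine ⟨O, hO, ?_, ?_⟩
    · rwa [eq O hO, app_eq h₀.opens_isFunc h]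
    · rw [eq O hO, app_eq h₀.opens_isFunc h]
      exact fun w hw => hUV (h₁.mono hWτ hU hWU hw)

/-- For an interpretable space, a filter completely prime over `M₀` generates a filter completely
prime over `M₁` on its interpretation in `M₁`. -/
theorem isPrimeFilter_generated (hM₀ : IsTransitiveModel M₀) (hM₁ : IsTransitiveModel M₁)
    (hsub : M₀ ⊆ M₁) (hX₀ : IsInterpretable M₀ X₀ τ₀)
    (hπ₀ : IsInterpretation M₁ M₀ X₀ τ₀ X₁ τ₁ p₀ q₀) {F : ZFSet.{u}}
    (hF : IsPrimeFilter M₀ X₀ τ₀ F) :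
    IsPrimeFilter M₁ X₁ τ₁ (ZFSet.sep (fun U => ∃ O ∈ F, app q₀ O ⊆ U) τ₁) := by
  have h₀ := hπ₀.1
  have hτ₁ := h₀.target.topology_mem
  refine ⟨ZFSet.sep_subset, ?_, ?_, ?_, ?_⟩
  · exact ZFSet.mem_sep.2 ⟨h₀.target.univ_open, X₀, hF.univ_mem, by rw [h₀.map_univ]⟩
  · intro U hU V hV
    obtain ⟨hU, O, hO, hOU⟩ := ZFSet.mem_sep.1 hU
    obtain ⟨hV, P, hP, hPV⟩ := ZFSet.mem_sep.1 hV
    refine ZFSet.mem_sep.2 ⟨h₀.target.inter_open _ hU _ hV, _, hF.inter_mem _ hO _ hP, ?_⟩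
    rw [h₀.map_inter O (hF.subset hO) P (hF.subset hP)]
    exact fun z hz => ZFSet.mem_inter.2
      ⟨hOU (ZFSet.mem_inter.1 hz).1, hPV (ZFSet.mem_inter.1 hz).2⟩
  · intro U hU V hV hUV
    obtain ⟨-, O, hO, hOU⟩ := ZFSet.mem_sep.1 hU
    exact ZFSet.mem_sep.2 ⟨hV, O, hO, fun z hz => hUV (hOU hz)⟩
  · intro C hC hCτ hCF
    obtain ⟨-, O, hO, hOC⟩ := ZFSet.mem_sep.1 hCF
    by_contra! hcon
    -- The trace of `C` on `τ₀`: since the sets `app q₀ P` form a basis of `X₁`, a filter in `M₁`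
    -- avoiding `C'` has its point outside every member of `C`.
    set C' := ZFSet.sep (fun P => ∃ U ∈ C, ∃ W ∈ τ₁, ZFSet.pair P W ∈ q₀ ∧ W ⊆ U) τ₀ with hC'def
    have hC' : C' ∈ M₁ := hM₁.sep_mem (hsub h₀.source.topology_mem) (hM₁.bex (.const hC)
      (hM₁.bex (.const hτ₁) (.and (hM₁.pairMem (.var _) (.var _) (.const h₀.opens_mem))
        (hM₁.subset (.var _) (.var _)))))
    obtain ⟨H, hHM, hH, hOH, hHC⟩ := exists_isPrimeFilter_of_isInterpretable hM₀ hM₁ hsub hX₀ hF hO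
      hC' ZFSet.sep_subset (fun P hP hPF => by
        obtain ⟨hPτ, U, hU, W, hW, hPW, hWU⟩ := ZFSet.mem_sep.1 hP
        refine hcon U hU (ZFSet.mem_sep.2 ⟨hCτ hU, P, hPF, ?_⟩)
        rwa [app_eq h₀.opens_isFunc hPW])
    obtain ⟨y, hy, hyH⟩ := hπ₀.exists_point hM₀ hM₁ hsub hHM hH
    have hyO : y ∈ app q₀ O := (hyH O (hF.subset hO)).2 hOH
    obtain ⟨U, hU, hyU⟩ := ZFSet.mem_sUnion.1 (hOC hyO)
    obtain ⟨P, hP, hyP, hPU⟩ := h₀.basis U (hCτ hU) y hyU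
    exact hHC P (ZFSet.mem_sep.2 ⟨hP, U, hU, app q₀ P, app_mem h₀.opens_isFunc hP,
      (pair_mem_iff h₀.opens_isFunc hP).2 rfl, hPU⟩) ((hyH P hP).1 hyP)

theorem exists_isFunc_univ {A B : ZFSet.{u}} (t : ZFSet.{u} → ZFSet.{u}) (ht : ∀ x ∈ A, t x ∈ B) :
    ∃ f, ZFSet.IsFunc A B f ∧ ∀ x ∈ A, app f x = t x := by
  have hmem : ∀ x y, ZFSet.pair x y ∈ ZFSet.sep (fun w => ∃ x, w = ZFSet.pair x (t x))
      (ZFSet.prod A B) ↔ x ∈ A ∧ y = t x := by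
    intro x y
    rw [ZFSet.mem_sep, ZFSet.pair_mem_prod]
    constructor
    · rintro ⟨⟨hx, -⟩, x', e⟩
      obtain ⟨rfl, rfl⟩ := ZFSet.pair_inj.1 e
      exact ⟨hx, rfl⟩
    · rintro ⟨hx, rfl⟩
      exact ⟨⟨hx, ht x hx⟩, x, rfl⟩
  have hf : ZFSet.IsFunc A B (ZFSet.sep (fun w => ∃ x, w = ZFSet.pair x (t x)) (ZFSet.prod A B)) :=
    ⟨ZFSet.sep_subset, fun x hx => ⟨t x, (hmem _ _).2 ⟨hx, rfl⟩, fun y hy => ((hmem _ _).1 hy).2⟩⟩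
  exact ⟨_, hf, fun x hx => app_eq hf ((hmem _ _).2 ⟨hx, rfl⟩)⟩


/-- Interpretations of interpretable spaces compose. -/
theorem isInterpretation_comp (hM₀ : IsTransitiveModel M₀) (hM₁ : IsTransitiveModel M₁)
    (hsub : M₀ ⊆ M₁) (hX₀ : IsInterpretable M₀ X₀ τ₀)
    (hπ₀ : IsInterpretation M₁ M₀ X₀ τ₀ X₁ τ₁ p₀ q₀)
    (hπ₁ : IsInterpretation Set.univ M₁ X₁ τ₁ X₂ τ₂ p₁ q₁) :
    IsInterpretation Set.univ M₀ X₀ τ₀ X₂ τ₂ (comp X₀ X₂ p₁ p₀) (comp τ₀ τ₂ q₁ q₀) := by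
  have hpre := isPreinterpretation_comp hM₁ hsub hπ₀.1 hπ₁.1 trivial trivial
  refine ⟨hpre, fun Y σ p q hY => ?_⟩
  have hpt : ∀ y ∈ Y, ∃ z ∈ X₂, ∀ O ∈ τ₀, z ∈ app (comp τ₀ τ₂ q₁ q₀) O ↔ y ∈ app q O := by
    intro y hy
    have hF := hY.isPrimeFilter hy
    obtain ⟨z, hz, hzF⟩ := hπ₁.exists_point hM₁ isTransitiveModel_univ (Set.subset_univ _) trivial
      (isPrimeFilter_generated hM₀ hM₁ hsub hX₀ hπ₀ hF)
    refine ⟨z, hz, fun O hO => ?_⟩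
    have hO₁ := app_mem hπ₀.1.opens_isFunc hO
    rw [app_comp hπ₀.1.opens_isFunc hπ₁.1.opens_isFunc hO, hzF _ hO₁, ZFSet.mem_sep,
      and_iff_right hO₁]
    constructor
    · rintro ⟨P, hP, hPO⟩
      obtain ⟨hPτ, hyP⟩ := ZFSet.mem_sep.1 hP
      -- `q₀` reflects inclusions, because membership of points of `X₀` is preserved in both
      -- directions.
      refine hY.mono hPτ hO (fun x hx => ?_) hyP
      have hxX := hY.source.subset P hPτ hx
      exact (hπ₀.1.mem_iff x hxX O hO).2 (hPO ((hπ₀.1.mem_iff x hxX P hPτ).1 hx))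
    · intro h
      exact ⟨O, ZFSet.mem_sep.2 ⟨hO, h⟩, fun _ h => h⟩
  choose! t ht ht' using hpt
  obtain ⟨h, hf, hh⟩ := exists_isFunc_univ t ht
  refine ⟨h, trivial, hf, fun x hx => ?_, fun O hO y hy => by rw [hh y hy, ht' y hy O hO]⟩
  have hpx := app_mem hY.points_isFunc hx
  rw [hh _ hpx]
  have hx₂ := app_mem hpre.points_isFunc hx
  have key : ∀ O ∈ τ₀, t (app p x) ∈ app (comp τ₀ τ₂ q₁ q₀) O ↔
      app (comp X₀ X₂ p₁ p₀) x ∈ app (comp τ₀ τ₂ q₁ q₀) O := fun O hO => by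
    rw [ht' _ hpx O hO, ← hY.mem_iff x hx O hO, ← hpre.mem_iff x hx O hO]
  -- The two points lie in the same basic open sets, so they coincide in the `T₀` space `X₂`.
  refine hpre.target.t0 _ (ht _ hpx) _ hx₂ fun U hU => ⟨fun hz => ?_, fun hz => ?_⟩
  · obtain ⟨O, hO, hzO, hOU⟩ := hpre.basis U hU _ hz
    exact hOU ((key O hO).1 hzO)
  · obtain ⟨O, hO, hzO, hOU⟩ := hpre.basis U hU _ hz
    exact hOU ((key O hO).2 hzO)

end TopInterp

theorem mainTheorem8 (M₀ M₁ : Set ZFSet.{u})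
    (hM₀ : TopInterp.IsTransitiveModel M₀) (hM₁ : TopInterp.IsTransitiveModel M₁)
    (hsub : M₀ ⊆ M₁)
    (X₀ τ₀ X₁ τ₁ X₂ τ₂ p₀ q₀ p₁ q₁ : ZFSet.{u})
    (hX₀ : TopInterp.IsInterpretable M₀ X₀ τ₀)
    (hπ₀ : TopInterp.IsInterpretation M₁ M₀ X₀ τ₀ X₁ τ₁ p₀ q₀)
    (hπ₁ : TopInterp.IsInterpretation Set.univ M₁ X₁ τ₁ X₂ τ₂ p₁ q₁) :
    TopInterp.IsInterpretation Set.univ M₀ X₀ τ₀ X₂ τ₂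
      (TopInterp.comp X₀ X₂ p₁ p₀) (TopInterp.comp τ₀ τ₂ q₁ q₀) := by
  exact TopInterp.isInterpretation_comp hM₀ hM₁ hsub hX₀ hπ₀ hπ₁
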